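/- Let $d=2$, $K(x)=-\dfrac{x_1x_2}{\pi|x|^4}$ for $x\in\mathbb R^2\setminus\{0\}$, $Q=[-\pi,\pi]^2$ and $\mathcal C=[-\frac12,\frac12]\subset\mathbb C$. (1) For every $\tau\in Q$ the Fourier series $$F(\tau)=\sum_{m\in\mathbb Z^2,\,m\neq0}K(m)\,e^{im\cdot\tau}$$ converges in the sense that its rectangular partial sums, over $|m_1|\le M_1$, $|m_2|\le M_2$, have a limit $F(\tau)$ as $M_1,M_2\to\infty$ independently. The function $F$ so defined belongs to $L^2(Q)$ and is also the unconditional sum of the series in $L^2(Q)$; it is the symbol of the infinite Toeplitz matrix with entries $K(m-n)$ for $m\ne n$ in $\mathbb Z^2$ and zero on the diagonal. Moreover $$F(\tau)\in\mathcal C\qquad\text{for all }\tau\in Q.$$ (2) Let $\Omega\subset\mathbb R^2$ be a bounded set (for instance a bounded domain) and $\lambda\in\mathbb C\setminus\mathcal C$. For every integer $N\ge1$ and every grid origin $a\in\mathbb R^2$, put $x_m=a+\frac mN$ $(m\in\mathbb Z^2)$, $\omega=\{m\in\mathbb Z^2: x_m\in\Omega\}$, and let $T^N$ be the matrix indexed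 by $\omega$ with entries $N^{-2}K(x_m-x_n)$ for $m\ne n$ and $0$ for $m=n$. Then for every right-hand side $(f_m)_{m\in\omega}$ in $\mathbb C^{\omega}$ the delta-delta system $$\lambda u_m-N^{-2}\sum_{n\in\omega,\,n\ne m}K(x_m-x_n)\,u_n=f_m\qquad(m\in\omega)$$ has a unique solution $(u_m)_{m\in\omega}\in\mathbb C^\omega$, the operator $\lambda\,\mathrm{Id}-T^N$ is invertible, and in the $\ell^2(\omega)$ operator norm $$\|(\lambda\,\mathrm{Id}-T^N)^{-1}\|\le \operatorname{dist}(\lambda,\mathcal C)^{-1}.$$ -/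

import Mathlib

namespace DeltaDelta

/-- The Euclidean plane. -/
abbrev Plane : Type := EuclideanSpace ℝ (Fin 2)

/-- The strongly singular kernel `K(x) = -x₁ x₂ / (π |x|⁴)`, for `x ≠ 0`. -/
noncomputable def kernel (x : Plane) : ℝ :=
  -(x 0 * x 1) / (Real.pi * ‖x‖ ^ 4)

/-- The lattice point `m ∈ ℤ²` seen as a point of the plane. -/
noncomputable def latticePoint (m : Fin 2 → ℤ) : Plane :=
  WithLp.toLp 2 fun i => (m i : ℝ)

/-- The Toeplitz coefficients: `K(m)` for `m ≠ 0`, and zero on the diagonal. -/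
noncomputable def toeplitzCoeff (m : Fin 2 → ℤ) : ℝ :=
  if m = 0 then 0 else kernel (latticePoint m)

/-- The period square `Q = [-π, π]²`. -/
def periodSquare : Set Plane :=
  {τ | ∀ i, τ i ∈ Set.Icc (-Real.pi) Real.pi}

/-- The partial sum over `m ∈ s` of the Fourier series `∑ K(m) e^{i m·τ}`. -/
noncomputable def fourierPartialSum (s : Finset (Fin 2 → ℤ)) (τ : Plane) : ℂ :=
  ∑ m ∈ s, (toeplitzCoeff m : ℂ) *
    Complex.exp (Complex.I * ((∑ i, (m i : ℝ) * τ i : ℝ) : ℂ))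

/-- The rectangle of lattice points `m` with `|m₁| ≤ M₁` and `|m₂| ≤ M₂`. -/
noncomputable def latticeBox (M : Fin 2 → ℕ) : Finset (Fin 2 → ℤ) :=
  Finset.Icc (fun i => -(M i : ℤ)) (fun i => (M i : ℤ))

/-- The Toeplitz symbol `F(τ) = ∑_{m ≠ 0} K(m) e^{i m·τ}`. The series is not absolutely convergent;
its value at `τ` is the limit of the rectangular partial sums as `M₁` and `M₂` tend to infinity
independently of each other. -/
noncomputable def symbol (τ : Plane) : ℂ :=
  Filter.limUnder Filter.atTop fun M : Fin 2 → ℕ => fourierPartialSum (latticeBox M) τ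

/-- The real interval `[-1/2, 1/2]` as a subset of the complex plane. -/
def idealSet : Set ℂ :=
  (fun t : ℝ => (t : ℂ)) '' Set.Icc (-1 / 2) (1 / 2)

/-- The grid point `x_m = a + m / N`. -/
noncomputable def gridPoint (a : Plane) (N : ℕ) (m : Fin 2 → ℤ) : Plane :=
  a + (N : ℝ)⁻¹ • latticePoint m

theorem finite_gridIndex {Ω : Set Plane} (hΩ : Bornology.IsBounded Ω) (a : Plane) {N : ℕ}
    (hN : 0 < N) : {m : Fin 2 → ℤ | gridPoint a N m ∈ Ω}.Finite := by
  obtain ⟨R, hR⟩ := hΩ.subset_closedBall a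
  have hN' : (0 : ℝ) < N := by exact_mod_cast hN
  refine (Set.finite_Icc (fun _ : Fin 2 => -⌈R * N⌉) (fun _ : Fin 2 => ⌈R * N⌉)).subset ?_
  intro m hm
  have h1 : ‖(N : ℝ)⁻¹ • latticePoint m‖ ≤ R := by
    have := hR hm
    rwa [Metric.mem_closedBall, gridPoint, dist_eq_norm, add_sub_cancel_left] at this
  have h2 : ∀ i, |(m i : ℝ)| ≤ R * N := by
    intro i
    have h3 : ‖latticePoint m i‖ ≤ ‖latticePoint m‖ := PiLp.norm_apply_le _ i
    rw [norm_smul, norm_inv, Real.norm_natCast, inv_mul_le_iff₀ hN'] at h1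
    calc |(m i : ℝ)| ≤ ‖latticePoint m‖ := h3
      _ ≤ R * N := by linarith
  constructor <;> intro i <;> have h4 := abs_le.1 (h2 i) <;> have h5 := Int.le_ceil (R * N)
  · have : (-⌈R * N⌉ : ℝ) ≤ m i := by linarith
    exact_mod_cast this
  · have : (m i : ℝ) ≤ ⌈R * N⌉ := by linarith
    exact_mod_cast this

/-- The finite index set `ω = {m ∈ ℤ² | x_m ∈ Ω}` of the grid points in the bounded set `Ω`. -/
noncomputable def gridIndex (Ω : Set Plane) (hΩ : Bornology.IsBounded Ω) (a : Plane) (N : ℕ)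
    (hN : 0 < N) : Finset (Fin 2 → ℤ) :=
  (finite_gridIndex hΩ a hN).toFinset

/-- The system matrix of the delta-delta scheme on the index set `ω`: its entries are
`N⁻² K(x_m - x_n)` off the diagonal, and zero on the diagonal. -/
noncomputable def systemMatrix (a : Plane) (N : ℕ) (ω : Finset (Fin 2 → ℤ)) : Matrix ω ω ℂ :=
  Matrix.of fun m n =>
    if m = n then 0
    else ((((N : ℝ) ^ 2)⁻¹ * kernel (gridPoint a N m - gridPoint a N n) : ℝ) : ℂ)

/-- The system matrix as a bounded operator on `ℓ²(ω)`. -/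
noncomputable def systemOperator (a : Plane) (N : ℕ) (ω : Finset (Fin 2 → ℤ)) :
    EuclideanSpace ℂ ω →L[ℂ] EuclideanSpace ℂ ω :=
  Matrix.toEuclideanCLM (n := ω) (𝕜 := ℂ) (systemMatrix a N ω)

end DeltaDelta

namespace DeltaDelta

open MeasureTheory Filter Topology

/-! Write `τ = (x, y)` and `t_k = y + 2πk`. On the lattice, `K` is `-1/π` times `profile`, and
`profile s` sampled at the integers is, up to a constant, the Fourier transform of `t e^{-2πs|t|}`.
Poisson summation in the second index (`hasSum_profile_mul_exp`) turns each inner sum into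
exponentials `t_k e^{-|m||t_k|}`. The outer sum over `m` is then geometric, which gives, for `y ≠
0`, `F(τ) = (sin x / 2) ∑_k t_k / (cosh t_k - cos x)`. The summand is odd in `t_k` and decreasing
beyond `3 < π`, so for `0 < y ≤ π` the sum behaves like an alternating one and lies between minus
its value at `2π - y` and its value at `y`. Since `|sin x| t ≤ |sin x| sinh t ≤ cosh t - cos x`,
this yields `|F| ≤ 1/2`. For `y = 0` every rectangular sum vanishes by oddness.

Independent limits in the two indices are justified by summation by parts: for `e^{iy} ≠ 1` the
truncated inner sums are `O(|m|^{-3/2})` uniformly in the truncation, so dominated convergence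
applies. Square summability of the coefficients gives the unconditional `L²` sum, which agrees a.e.
with the pointwise limit.

For the system, homogeneity of `K` cancels `N^{-2}`, so the matrix is a finite section of the
Toeplitz matrix. Its quadratic form is `(2π)^{-2} ∫ |p|² F` with `p` a trigonometric polynomial;
hence its numerical range lies in `[-1/2, 1/2]`, and the resolvent bound follows. -/

/-- The profile `s t / (s² + t²)²` of the kernel. -/
noncomputable def profile (s t : ℝ) : ℝ := s * t / (s ^ 2 + t ^ 2) ^ 2

/-! ### Fourier transform of `t e^{-s|t|}` and Poisson summation in the second index. -/

/-- The constant is `3!`, from `u³/3! ≤ e^u`; the resulting quadratic decay is what Poisson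
summation requires. -/
theorem abs_mul_exp_neg_le {s : ℝ} (hs : 0 < s) (t : ℝ) :
    |t| * Real.exp (-s * |t|) ≤ 6 / s ^ 3 * |t| ^ (-2 : ℝ) := by
  rcases eq_or_ne t 0 with rfl | ht
  · simp
  have ht' : 0 < |t| := abs_pos.2 ht
  have h1 : (s * |t|) ^ 3 / 6 ≤ Real.exp (s * |t|) := by
    simpa [Nat.factorial] using Real.pow_div_factorial_le_exp (s * |t|) (by positivity) 3
  rw [neg_mul, Real.exp_neg, Real.rpow_neg ht'.le, ← div_eq_mul_inv, ← div_eq_mul_inv, div_div,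
    div_le_div_iff₀ (Real.exp_pos _) (by positivity)]
  rw [show |t| ^ (2 : ℝ) = |t| ^ 2 by exact_mod_cast Real.rpow_natCast |t| 2]
  nlinarith [mul_pow s |t| 3]

theorem integrableOn_mul_exp_neg {c : ℂ} (hc : 0 < c.re) :
    IntegrableOn (fun t : ℝ => (t : ℂ) * Complex.exp (-c * t)) (Set.Ioi 0) := by
  have h := integrableOn_rpow_mul_exp_neg_mul_rpow (p := 1) (s := 1) (b := c.re)
    (by norm_num) one_pos hc
  refine Integrable.mono' h (Continuous.aestronglyMeasurable (by fun_prop)) ?_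
  filter_upwards [ae_restrict_mem measurableSet_Ioi] with t ht
  have ht' : (0 : ℝ) < t := ht
  simp [Complex.norm_exp, abs_of_pos ht']

theorem integral_mul_exp_neg {c : ℂ} (hc : 0 < c.re) :
    ∫ t : ℝ in Set.Ioi 0, (t : ℂ) * Complex.exp (-c * t) = 1 / c ^ 2 := by
  have hc0 : c ≠ 0 := by rintro rfl; simp at hc
  have hderiv : ∀ t : ℝ, HasDerivAt
      (fun t : ℝ => -((t : ℂ) / c + 1 / c ^ 2) * Complex.exp (-c * t))
      ((t : ℂ) * Complex.exp (-c * t)) t := by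
    intro t
    have h0 : HasDerivAt (fun t : ℝ => (t : ℂ)) 1 t := Complex.ofRealCLM.hasDerivAt
    have h1 := ((h0.div_const c).add_const (1 / c ^ 2)).neg
    have h2 := (h0.const_mul (-c)).cexp
    refine (h1.mul h2).congr_deriv ?_
    simp only [Pi.neg_apply]
    field_simp
    ring
  have hlim : Tendsto (fun t : ℝ => -((t : ℂ) / c + 1 / c ^ 2) * Complex.exp (-c * t))
      atTop (𝓝 0) := by
    have h1 : Tendsto (fun t : ℝ => (t : ℂ) * Complex.exp (-c * t)) atTop (𝓝 0) := by
      rw [tendsto_zero_iff_norm_tendsto_zero]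
      have h := (Real.tendsto_pow_mul_exp_neg_atTop_nhds_zero 1).comp
        (tendsto_id.const_mul_atTop hc)
      have h' := h.const_mul (c.re)⁻¹
      rw [mul_zero] at h'
      refine h'.congr' ?_
      filter_upwards [eventually_gt_atTop 0] with t ht
      simp [Complex.norm_exp, abs_of_pos ht]
      field_simp
    have h2 : Tendsto (fun t : ℝ => Complex.exp (-c * t)) atTop (𝓝 0) := by
      rw [tendsto_zero_iff_norm_tendsto_zero]
      have h := Real.tendsto_exp_neg_atTop_nhds_zero.comp (tendsto_id.const_mul_atTop hc)
      refine h.congr ?_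
      intro t
      simp [Complex.norm_exp]
    have h3 := (h1.mul_const (-1 / c)).add (h2.mul_const (-1 / c ^ 2))
    rw [zero_mul, zero_mul, add_zero] at h3
    refine h3.congr ?_
    intro t
    field_simp
    ring
  have := integral_Ioi_of_hasDerivAt_of_tendsto' (a := (0 : ℝ)) (fun t _ => hderiv t)
    (integrableOn_mul_exp_neg hc) hlim
  rw [this]
  simp

/-- Splitting at `0` leaves two Laplace integrals, with parameters `s ± 2πiw`; oddness of the
function produces the minus sign. -/
theorem fourier_mul_exp_neg_abs {s : ℝ} (hs : 0 < s) (w : ℝ) :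
    FourierTransform.fourier
        (fun t : ℝ => (t : ℂ) * Complex.exp (-((s * |t| : ℝ) : ℂ))) w =
      1 / ((s : ℂ) + 2 * Real.pi * w * Complex.I) ^ 2
        - 1 / ((s : ℂ) - 2 * Real.pi * w * Complex.I) ^ 2 := by
  rw [Real.fourier_real_eq_integral_exp_smul]
  have hp : 0 < ((s : ℂ) + 2 * Real.pi * w * Complex.I).re := by simpa using hs
  have hm : 0 < ((s : ℂ) - 2 * Real.pi * w * Complex.I).re := by simpa using hs
  set g : ℝ → ℂ := fun v => Complex.exp (((-2 * Real.pi * v * w : ℝ) : ℂ) * Complex.I) •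
    ((v : ℂ) * Complex.exp (-((s * |v| : ℝ) : ℂ))) with hg
  have e1 : Set.EqOn (fun t : ℝ => (t : ℂ) *
      Complex.exp (-((s : ℂ) + 2 * Real.pi * w * Complex.I) * t)) g (Set.Ioi 0) := by
    intro t ht
    have ht' : (0 : ℝ) < t := ht
    simp only [hg, smul_eq_mul, abs_of_pos ht']
    rw [mul_left_comm, ← Complex.exp_add]
    congr 2
    push_cast
    ring
  have e2 : Set.EqOn (fun t : ℝ => -((t : ℂ) *
      Complex.exp (-((s : ℂ) - 2 * Real.pi * w * Complex.I) * t))) (fun t => g (-t))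
      (Set.Ioi 0) := by
    intro t ht
    have ht' : (0 : ℝ) < t := ht
    simp only [hg, smul_eq_mul, abs_neg, abs_of_pos ht']
    rw [mul_left_comm, ← Complex.exp_add]
    push_cast
    rw [neg_mul_eq_neg_mul]
    congr 2
    ring
  have i1 : IntegrableOn g (Set.Ioi 0) :=
    (integrableOn_mul_exp_neg hp).congr_fun e1 measurableSet_Ioi
  have i2 : IntegrableOn g (Set.Iic 0) := by
    have h := (integrableOn_mul_exp_neg hm).neg.congr_fun e2 measurableSet_Ioi
    rw [integrableOn_Iic_iff_integrableOn_Iio]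
    have := (Measure.measurePreserving_neg (volume : Measure ℝ)).integrableOn_comp_preimage
      (Homeomorph.neg ℝ).measurableEmbedding (f := g) (s := Set.Iio 0)
    rw [← this]
    simpa [Function.comp_def] using h
  rw [← intervalIntegral.integral_Iic_add_Ioi i2 i1, ← setIntegral_congr_fun measurableSet_Ioi e1,
    integral_mul_exp_neg hp]
  have h2 : ∫ t in Set.Iic 0, g t = -(1 / ((s : ℂ) - 2 * Real.pi * w * Complex.I) ^ 2) := by
    have := integral_comp_neg_Ioi (0 : ℝ) g
    rw [neg_zero] at this
    rw [← this, ← setIntegral_congr_fun measurableSet_Ioi e2, integral_neg,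
      integral_mul_exp_neg hm]
  rw [h2]
  ring

theorem abs_profile_le {s : ℝ} (hs : 1 ≤ |s|) (t : ℝ) :
    |profile s t| ≤ (1 + t ^ 2)⁻¹ := by
  have hs' : 1 ≤ s ^ 2 := by nlinarith [sq_abs s, abs_nonneg s]
  have h0 : 0 < s ^ 2 + t ^ 2 := by positivity
  rw [profile, abs_div, abs_of_pos (pow_pos h0 2), div_le_iff₀ (by positivity),
    inv_mul_eq_div, le_div_iff₀ (by positivity)]
  have h1 : |s * t| ≤ s ^ 2 + t ^ 2 := by
    rw [abs_mul]; nlinarith [sq_abs s, sq_abs t, sq_nonneg (|s| - |t|)]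
  calc |s * t| * (1 + t ^ 2) ≤ (s ^ 2 + t ^ 2) * (s ^ 2 + t ^ 2) := by gcongr
    _ = _ := by ring

theorem summable_inv_one_add_sq : Summable fun n : ℤ => (1 + (n : ℝ) ^ 2)⁻¹ := by
  refine Summable.of_norm_bounded_eventually (g := fun n : ℤ => |(n : ℝ)| ^ (-2 : ℝ))
    (Real.summable_abs_int_rpow (by norm_num)) ?_
  refine (Set.finite_singleton (0 : ℤ)).subset ?_
  intro n hn
  by_contra h
  apply hn
  have h' : (0 : ℝ) < |(n : ℝ)| := abs_pos.2 (by exact_mod_cast h)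
  change ‖(1 + (n : ℝ) ^ 2)⁻¹‖ ≤ |(n : ℝ)| ^ (-2 : ℝ)
  rw [Real.rpow_neg h'.le, show |(n : ℝ)| ^ (2 : ℝ) = |(n : ℝ)| ^ 2 by
    exact_mod_cast Real.rpow_natCast |(n : ℝ)| 2, sq_abs, Real.norm_of_nonneg (by positivity)]
  have : (0 : ℝ) < (n : ℝ) ^ 2 := by rw [← sq_abs]; positivity
  gcongr
  linarith

theorem summable_profile {s : ℝ} (hs : 1 ≤ |s|) : Summable fun n : ℤ => |profile s n| :=
  Summable.of_nonneg_of_le (fun _ => abs_nonneg _) (fun n => abs_profile_le hs n)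
    summable_inv_one_add_sq

theorem norm_exp_mul_I_eq_one (x : ℝ) : ‖Complex.exp (Complex.I * x)‖ = 1 := by
  rw [mul_comm]; exact Complex.norm_exp_ofReal_mul_I x

/-- The translates of `y` by the period lattice. -/
noncomputable def translate (y : ℝ) (k : ℤ) : ℝ := y + 2 * Real.pi * k

theorem hasSum_profile_mul_exp {s : ℝ} (hs : 1 ≤ s) (y : ℝ) :
    HasSum (fun n : ℤ => (profile s n : ℂ) * Complex.exp (Complex.I * ((n * y : ℝ) : ℂ)))
      (Real.pi * Complex.I / 2 *
        ∑' k : ℤ, ((translate y k * Real.exp (-s * |translate y k|) : ℝ) : ℂ)) := by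
  have hpi := Real.pi_pos
  have hs0 : 0 < s := by linarith
  have hσ : 0 < 2 * Real.pi * s := by positivity
  have hsum : Summable fun n : ℤ =>
      (profile s n : ℂ) * Complex.exp (Complex.I * ((n * y : ℝ) : ℂ)) := by
    refine Summable.of_norm ?_
    refine (summable_profile (hs.trans (le_abs_self s))).congr fun n => ?_
    rw [norm_mul, norm_exp_mul_I_eq_one, mul_one, Complex.norm_real, Real.norm_eq_abs]
  have hF : ∀ n : ℤ, FourierTransform.fourier (fun t : ℝ => (t : ℂ) *
      Complex.exp (-((2 * Real.pi * s * |t| : ℝ) : ℂ))) (n : ℝ) =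
        -Complex.I / Real.pi ^ 2 * (profile s n : ℂ) := by
    intro n
    rw [fourier_mul_exp_neg_abs hσ]
    have h1 : (s : ℂ) + n * Complex.I ≠ 0 := by
      intro h
      have := congrArg Complex.re h
      simp at this
      linarith
    have h2 : (s : ℂ) - n * Complex.I ≠ 0 := by
      intro h
      have := congrArg Complex.re h
      simp at this
      linarith
    have h3 : ((s : ℂ) ^ 2 + n ^ 2) = (s + n * Complex.I) * (s - n * Complex.I) := by
      linear_combination (n : ℂ) ^ 2 * Complex.I_sq
    have h4 : (Real.pi : ℂ) ≠ 0 := by exact_mod_cast hpi.ne'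
    rw [profile]
    push_cast
    rw [h3, show (2 * Real.pi * s + 2 * Real.pi * n * Complex.I : ℂ) =
      2 * Real.pi * (s + n * Complex.I) by ring,
      show (2 * Real.pi * s - 2 * Real.pi * n * Complex.I : ℂ) =
      2 * Real.pi * (s - n * Complex.I) by ring]
    field_simp
    ring
  -- Evaluation at `y/(2π)` makes the shifts by integers into `t_k/(2π)` and the unit-circle
  -- characters into `e^{iny}`.
  have hP := Real.tsum_eq_tsum_fourier_of_rpow_decay_of_summable
    (f := fun t : ℝ => (t : ℂ) * Complex.exp (-((2 * Real.pi * s * |t| : ℝ) : ℂ)))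
    (by fun_prop) (b := 2) one_lt_two ?_ ?_ (y / (2 * Real.pi))
  · rw [hsum.hasSum_iff]
    have hL : ∀ k : ℤ, (((y / (2 * Real.pi) + k : ℝ) : ℂ) *
        Complex.exp (-((2 * Real.pi * s * |y / (2 * Real.pi) + k| : ℝ) : ℂ))) =
        (1 / (2 * Real.pi)) * ((translate y k * Real.exp (-s * |translate y k|) : ℝ) : ℂ) := by
      intro k
      have e : y / (2 * Real.pi) + k = (2 * Real.pi)⁻¹ * translate y k := by
        rw [translate]; field_simp
      rw [e, abs_mul, abs_of_pos (show 0 < (2 * Real.pi)⁻¹ by positivity)]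
      push_cast
      rw [show (-(2 * Real.pi * s * ((2 * (Real.pi : ℂ))⁻¹ * (|translate y k| : ℝ)) : ℂ)) =
        -s * (|translate y k| : ℝ) by
          have : (Real.pi : ℂ) ≠ 0 := by exact_mod_cast hpi.ne'
          field_simp]
      ring
    have hR : ∀ n : ℤ, FourierTransform.fourier (fun t : ℝ => (t : ℂ) *
        Complex.exp (-((2 * Real.pi * s * |t| : ℝ) : ℂ))) (n : ℝ) *
          fourier n ((y / (2 * Real.pi) : ℝ) : UnitAddCircle) =
        -Complex.I / Real.pi ^ 2 *
          ((profile s n : ℂ) * Complex.exp (Complex.I * ((n * y : ℝ) : ℂ))) := by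
      intro n
      rw [hF, fourier_coe_apply, mul_assoc]
      congr 3
      have : (Real.pi : ℂ) ≠ 0 := by exact_mod_cast hpi.ne'
      push_cast
      field_simp
    simp only [hL, hR, tsum_mul_left] at hP
    have : (Real.pi : ℂ) ≠ 0 := by exact_mod_cast hpi.ne'
    have h5 : ∀ A B : ℂ, 1 / (2 * Real.pi) * A = -Complex.I / Real.pi ^ 2 * B →
        B = Real.pi * Complex.I / 2 * A := by
      intro A B h
      field_simp at h
      linear_combination (-Complex.I / 2) * h + B * Complex.I_sq
    exact h5 _ _ hP
  · refine Asymptotics.IsBigO.of_bound (6 / (2 * Real.pi * s) ^ 3) (Eventually.of_forall ?_)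
    intro t
    have := abs_mul_exp_neg_le hσ t
    rw [norm_mul, Complex.norm_exp, Complex.norm_real, Real.norm_eq_abs,
      Real.norm_of_nonneg (by positivity), Complex.neg_re, Complex.ofReal_re]
    rwa [neg_mul] at this
  · simp only [hF]
    refine Summable.mul_left _ ?_
    exact Complex.summable_ofReal.2 (summable_profile (hs.trans (le_abs_self s))).of_abs

/-! ### Uniform bounds by summation by parts, and the rectangular limit. -/

theorem abs_profile_add_one_sub_le {s : ℝ} (hs : 1 ≤ |s|) (t : ℝ) :
    |profile s (t + 1) - profile s t| ≤ 16 * (|s| / (s ^ 2 + t ^ 2) ^ 2) := by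
  have hs' : 1 ≤ s ^ 2 := by nlinarith [sq_abs s, abs_nonneg s]
  have hA : 0 < s ^ 2 + t ^ 2 := by positivity
  have hB : 1 ≤ s ^ 2 + (t + 1) ^ 2 := by nlinarith [sq_nonneg (t + 1)]
  obtain ⟨u, hu⟩ : ∃ u, u = t + 1 := ⟨_, rfl⟩
  obtain ⟨A, hA'⟩ : ∃ A, A = s ^ 2 + t ^ 2 := ⟨_, rfl⟩
  obtain ⟨B, hB'⟩ : ∃ B, B = s ^ 2 + u ^ 2 := ⟨_, rfl⟩
  have hAB : A = B - (2 * u - 1) := by rw [hA', hB', hu]; ring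
  have hB1 : 1 ≤ B := by rw [hB', hu]; exact hB
  have hu2 : u ^ 2 ≤ B := by rw [hB']; nlinarith
  have huB : |u| ≤ B := by nlinarith [sq_abs u, abs_nonneg u]
  have key : |u * A ^ 2 - t * B ^ 2| ≤ 16 * B ^ 2 := by
    -- Eliminating `A` and `t` leaves a polynomial in `u` and `B`; as `u²` and `|u|` are at most
    -- `B`, the three groups contribute `1 + 6 + 9 = 16` times `B²`.
    have e : u * A ^ 2 - t * B ^ 2 = B ^ 2 - (4 * u ^ 2 - 2 * u) * B
        + (4 * u * u ^ 2 - 4 * u ^ 2 + u) := by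
      rw [hAB, show t = u - 1 by linarith]; ring
    have h1 : |(4 * u ^ 2 - 2 * u) * B| ≤ 6 * B ^ 2 := by
      rw [abs_mul, abs_of_pos (show 0 < B by linarith)]
      have : |4 * u ^ 2 - 2 * u| ≤ 6 * B := by
        refine (abs_sub _ _).trans ?_
        rw [abs_mul, abs_mul, abs_of_nonneg (sq_nonneg u)]
        norm_num
        linarith
      nlinarith
    have h2 : |4 * u * u ^ 2 - 4 * u ^ 2 + u| ≤ 9 * B ^ 2 := by
      refine (abs_add_le _ _).trans ((add_le_add (abs_sub _ _) le_rfl).trans ?_)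
      rw [abs_mul, abs_mul, abs_mul, abs_of_nonneg (sq_nonneg u)]
      norm_num
      have : |u| * u ^ 2 ≤ B * B := by gcongr
      nlinarith
    rw [e]
    refine (abs_add_le _ _).trans ((add_le_add (abs_sub _ _) le_rfl).trans ?_)
    rw [abs_of_nonneg (sq_nonneg B)]
    linarith
  have hA0 : 0 < A := by rw [hA']; exact hA
  have e2 : profile s (t + 1) - profile s t = s * (u * A ^ 2 - t * B ^ 2) / (A ^ 2 * B ^ 2) := by
    rw [profile, profile, ← hu, ← hA', ← hB']
    field_simp
  rw [e2, ← hA', abs_div, abs_mul, abs_of_pos (show 0 < A ^ 2 * B ^ 2 by positivity),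
    ← mul_div_assoc, div_le_div_iff₀ (by positivity) (by positivity)]
  calc |s| * |u * A ^ 2 - t * B ^ 2| * A ^ 2 ≤ |s| * (16 * B ^ 2) * A ^ 2 := by gcongr
    _ = _ := by ring

/-- The exponent `2 = 5/4 + 3/4` is split between `s²` and `1 + t²` so that both resulting powers
are summable over the integers. -/
theorem abs_div_sq_le {s : ℝ} (hs : 1 ≤ |s|) (t : ℝ) :
    |s| / (s ^ 2 + t ^ 2) ^ 2 ≤ |s| ^ (-(3 / 2) : ℝ) * (1 + t ^ 2) ^ (-(3 / 4) : ℝ) := by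
  have hs0 : 0 < |s| := by linarith
  have hs' : 1 ≤ s ^ 2 := by nlinarith [sq_abs s, abs_nonneg s]
  have hA : 0 < s ^ 2 + t ^ 2 := by positivity
  have h1 : (s ^ 2) ^ (5 / 4 : ℝ) * (1 + t ^ 2) ^ (3 / 4 : ℝ) ≤ (s ^ 2 + t ^ 2) ^ 2 := by
    calc (s ^ 2) ^ (5 / 4 : ℝ) * (1 + t ^ 2) ^ (3 / 4 : ℝ)
        ≤ (s ^ 2 + t ^ 2) ^ (5 / 4 : ℝ) * (s ^ 2 + t ^ 2) ^ (3 / 4 : ℝ) := by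
          gcongr
          · linarith [sq_nonneg t]
      _ = (s ^ 2 + t ^ 2) ^ 2 := by
          rw [← Real.rpow_add hA]; norm_num
  have h2 : (s ^ 2) ^ (5 / 4 : ℝ) = |s| ^ (3 / 2 : ℝ) * |s| := by
    rw [← sq_abs, ← Real.rpow_natCast, ← Real.rpow_mul hs0.le]
    nth_rewrite 3 [← Real.rpow_one |s|]
    rw [← Real.rpow_add hs0]
    norm_num
  rw [Real.rpow_neg hs0.le, Real.rpow_neg (by positivity), ← mul_inv, ← one_div,
    div_le_div_iff₀ (by positivity) (by positivity), one_mul]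
  calc |s| * (|s| ^ (3 / 2 : ℝ) * (1 + t ^ 2) ^ (3 / 4 : ℝ))
      = (|s| ^ (3 / 2 : ℝ) * |s|) * (1 + t ^ 2) ^ (3 / 4 : ℝ) := by ring
    _ ≤ _ := by rw [← h2]; exact h1

theorem summable_one_add_sq_rpow :
    Summable fun n : ℤ => (1 + (n : ℝ) ^ 2) ^ (-(3 / 4) : ℝ) := by
  refine Summable.of_norm_bounded_eventually (g := fun n : ℤ => |(n : ℝ)| ^ (-(3 / 2) : ℝ))
    (Real.summable_abs_int_rpow (by norm_num)) ?_
  refine (Set.finite_singleton (0 : ℤ)).subset ?_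
  intro n hn
  by_contra h
  apply hn
  have h' : (0 : ℝ) < |(n : ℝ)| := abs_pos.2 (by exact_mod_cast h)
  change ‖(1 + (n : ℝ) ^ 2) ^ (-(3 / 4) : ℝ)‖ ≤ |(n : ℝ)| ^ (-(3 / 2) : ℝ)
  rw [Real.norm_of_nonneg (by positivity), Real.rpow_neg h'.le, Real.rpow_neg (by positivity)]
  have e : |(n : ℝ)| ^ (3 / 2 : ℝ) = ((n : ℝ) ^ 2) ^ (3 / 4 : ℝ) := by
    rw [← sq_abs, ← Real.rpow_natCast, ← Real.rpow_mul h'.le]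
    norm_num
  rw [e]
  have : (0 : ℝ) < (n : ℝ) ^ 2 := by rw [← sq_abs]; positivity
  gcongr
  linarith

/-- Controls the boundary terms of the summation by parts. The natural bound `s^{-2}` is weakened to
match the power from `abs_div_sq_le`. -/
theorem abs_profile_le_rpow {s : ℝ} (hs : 1 ≤ |s|) (t : ℝ) :
    |profile s t| ≤ |s| ^ (-(3 / 2) : ℝ) := by
  have hs0 : 0 < |s| := by linarith
  have h1 : |s * t| ≤ s ^ 2 + t ^ 2 := by
    rw [abs_mul]; nlinarith [sq_abs s, sq_abs t, sq_nonneg (|s| - |t|)]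
  have h3 : (0 : ℝ) < s ^ 2 := by rw [← sq_abs]; positivity
  have h0 : 0 < s ^ 2 + t ^ 2 := by positivity
  calc |profile s t| = |s * t| / (s ^ 2 + t ^ 2) ^ 2 := by
        rw [profile, abs_div, abs_of_pos (pow_pos h0 2)]
    _ ≤ (s ^ 2 + t ^ 2) / (s ^ 2 + t ^ 2) ^ 2 := by gcongr
    _ = (s ^ 2 + t ^ 2)⁻¹ := by field_simp
    _ ≤ (s ^ 2)⁻¹ := by gcongr; nlinarith [sq_nonneg t]
    _ = |s| ^ (-2 : ℝ) := by
        rw [Real.rpow_neg hs0.le, show |s| ^ (2 : ℝ) = |s| ^ 2 by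
          exact_mod_cast Real.rpow_natCast |s| 2, sq_abs]
    _ ≤ _ := Real.rpow_le_rpow_of_exponent_le hs (by norm_num)

theorem Icc_neg_succ (M : ℕ) : Finset.Icc (-((M + 1 : ℕ) : ℤ)) ((M + 1 : ℕ) : ℤ) =
    insert (-((M + 1 : ℕ) : ℤ)) (insert ((M + 1 : ℕ) : ℤ) (Finset.Icc (-(M : ℤ)) M)) := by
  ext n
  simp only [Finset.mem_Icc, Finset.mem_insert]
  push_cast
  omega

theorem sum_Icc_neg_telescope (f : ℤ → ℂ) (M : ℕ) :
    ∑ n ∈ Finset.Icc (-(M : ℤ)) M, (f n - f (n + 1)) = f (-M) - f (M + 1) := by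
  induction M with
  | zero => simp
  | succ M ih =>
    rw [Icc_neg_succ, Finset.sum_insert, Finset.sum_insert, ih]
    · push_cast
      rw [show (-((M : ℤ) + 1) + 1) = -M by ring]
      ring
    · simp only [Finset.mem_Icc]; push_cast; omega
    · simp only [Finset.mem_Icc, Finset.mem_insert]; push_cast; omega

/-- Multiplication by `1 - e^{iy}` replaces the coefficients by their differences, which are
summable with a power of `|s|` to spare, plus two boundary terms. The bound does not depend on `M`.
-/
theorem norm_profile_sum_le {s : ℝ} (hs : 1 ≤ |s|) (y : ℝ) (M : ℕ) :
    ‖1 - Complex.exp (Complex.I * y)‖ * ‖∑ n ∈ Finset.Icc (-(M : ℤ)) M,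
        (profile s n : ℂ) * Complex.exp (Complex.I * ((n * y : ℝ) : ℂ))‖ ≤
      (16 * ∑' n : ℤ, (1 + (n : ℝ) ^ 2) ^ (-(3 / 4) : ℝ) + 2) * |s| ^ (-(3 / 2) : ℝ) := by
  set e : ℤ → ℂ := fun n => Complex.exp (Complex.I * ((n * y : ℝ) : ℂ)) with he
  have he1 : ∀ n, ‖e n‖ = 1 := fun n => norm_exp_mul_I_eq_one _
  have hsucc : ∀ n, Complex.exp (Complex.I * y) * e n = e (n + 1) := by
    intro n
    simp only [he]
    rw [← Complex.exp_add]
    push_cast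
    ring_nf
  have hid : (1 - Complex.exp (Complex.I * y)) * ∑ n ∈ Finset.Icc (-(M : ℤ)) M,
      (profile s n : ℂ) * e n =
      ∑ n ∈ Finset.Icc (-(M : ℤ)) M,
          ((profile s (n + 1) - profile s n : ℝ) : ℂ) * e (n + 1)
        + ((profile s ((-M : ℤ) : ℝ) : ℂ) * e (-M)
          - (profile s ((M + 1 : ℤ) : ℝ) : ℂ) * e (M + 1)) := by
    rw [← sum_Icc_neg_telescope (fun n => (profile s n : ℂ) * e n), ← Finset.sum_add_distrib,
      Finset.mul_sum]
    refine Finset.sum_congr rfl fun n _ => ?_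
    rw [← hsucc]
    push_cast
    ring
  rw [← norm_mul, hid]
  have hb1 : ‖∑ n ∈ Finset.Icc (-(M : ℤ)) M,
      ((profile s (n + 1) - profile s n : ℝ) : ℂ) * e (n + 1)‖ ≤
      16 * (|s| ^ (-(3 / 2) : ℝ) * ∑' n : ℤ, (1 + (n : ℝ) ^ 2) ^ (-(3 / 4) : ℝ)) := by
    refine (norm_sum_le _ _).trans ?_
    calc _ ≤ ∑ n ∈ Finset.Icc (-(M : ℤ)) M,
          16 * (|s| ^ (-(3 / 2) : ℝ) * (1 + (n : ℝ) ^ 2) ^ (-(3 / 4) : ℝ)) := by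
          refine Finset.sum_le_sum fun n _ => ?_
          rw [norm_mul, he1, mul_one, Complex.norm_real, Real.norm_eq_abs]
          exact (abs_profile_add_one_sub_le hs n).trans
            (mul_le_mul_of_nonneg_left (abs_div_sq_le hs n) (by norm_num))
      _ ≤ _ := by
          rw [← Finset.mul_sum, ← Finset.mul_sum]
          gcongr
          exact summable_one_add_sq_rpow.sum_le_tsum _ fun n _ => by positivity
  have hb2 : ∀ n k : ℤ, ‖(profile s (n : ℝ) : ℂ) * e k‖ ≤ |s| ^ (-(3 / 2) : ℝ) := by
    intro n k
    rw [norm_mul, he1, mul_one, Complex.norm_real, Real.norm_eq_abs]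
    exact abs_profile_le_rpow hs n
  calc _ ≤ 16 * (|s| ^ (-(3 / 2) : ℝ) * ∑' n : ℤ, (1 + (n : ℝ) ^ 2) ^ (-(3 / 4) : ℝ))
        + (|s| ^ (-(3 / 2) : ℝ) + |s| ^ (-(3 / 2) : ℝ)) :=
        (norm_add_le _ _).trans (add_le_add hb1 ((norm_sub_le _ _).trans
          (add_le_add (hb2 _ _) (hb2 _ _))))
    _ = _ := by ring

theorem tendsto_apply_atTop (i : Fin 2) : Tendsto (fun M : Fin 2 → ℕ => M i) atTop atTop :=
  tendsto_atTop.2 fun b => eventually_atTop.2 ⟨fun _ => b, fun _ hM => hM i⟩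

theorem toeplitzCoeff_eq (m : Fin 2 → ℤ) :
    toeplitzCoeff m = -(1 / Real.pi) * profile (m 0) (m 1) := by
  rw [toeplitzCoeff, profile]
  split_ifs with h
  · simp [h]
  · have : ‖latticePoint m‖ ^ 2 = (m 0 : ℝ) ^ 2 + (m 1 : ℝ) ^ 2 := by
      rw [EuclideanSpace.norm_sq_eq]
      simp [latticePoint, Fin.sum_univ_two]
    rw [kernel, show ‖latticePoint m‖ ^ 4 = (‖latticePoint m‖ ^ 2) ^ 2 by ring, this]
    simp only [latticePoint]
    have := Real.pi_ne_zero
    rw [neg_div, neg_mul, one_div, mul_comm Real.pi, ← div_div]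
    ring

theorem fourierPartialSum_latticeBox (M : Fin 2 → ℕ) (τ : Plane) :
    fourierPartialSum (latticeBox M) τ =
      ∑ m ∈ Finset.Icc (-(M 0 : ℤ)) (M 0),
        -(1 / Real.pi : ℂ) * Complex.exp (Complex.I * ((m * τ 0 : ℝ) : ℂ)) *
        ∑ n ∈ Finset.Icc (-(M 1 : ℤ)) (M 1),
          (profile m n : ℂ) * Complex.exp (Complex.I * ((n * τ 1 : ℝ) : ℂ)) := by
  simp_rw [Finset.mul_sum]
  rw [← Finset.sum_product', fourierPartialSum]
  refine Finset.sum_nbij' (fun m => (m 0, m 1)) (fun p => ![p.1, p.2]) ?_ ?_ ?_ ?_ ?_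
  · intro m hm
    simp only [latticeBox, Finset.mem_Icc, Pi.le_def, Fin.forall_fin_two] at hm
    simp only [Finset.mem_product, Finset.mem_Icc]
    tauto
  · intro p hp
    simp only [Finset.mem_product, Finset.mem_Icc] at hp
    simp only [latticeBox, Finset.mem_Icc, Pi.le_def, Fin.forall_fin_two]
    simpa using by tauto
  · intro m _
    ext i
    fin_cases i <;> rfl
  · intro p _
    rfl
  · intro m _
    rw [toeplitzCoeff_eq, Fin.sum_univ_two]
    push_cast
    rw [mul_add, Complex.exp_add]
    ring

theorem profile_zero_left (t : ℝ) : profile 0 t = 0 := by simp [profile]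

theorem tendsto_fourierPartialSum_latticeBox_tsum (τ : Plane)
    (hτ : Complex.exp (Complex.I * (τ 1 : ℝ)) ≠ 1) (L : ℤ → ℂ)
    (hL : ∀ m : ℤ, HasSum (fun n : ℤ =>
      (profile m n : ℂ) * Complex.exp (Complex.I * ((n * τ 1 : ℝ) : ℂ))) (L m)) :
    Tendsto (fun M : Fin 2 → ℕ => fourierPartialSum (latticeBox M) τ) atTop
      (𝓝 (∑' m : ℤ, -(1 / Real.pi : ℂ) * Complex.exp (Complex.I * ((m * τ 0 : ℝ) : ℂ)) * L m)) := by
  set S : ℤ → ℕ → ℂ := fun m N => ∑ n ∈ Finset.Icc (-(N : ℤ)) N,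
      (profile m n : ℂ) * Complex.exp (Complex.I * ((n * τ 1 : ℝ) : ℂ)) with hS
  set w : ℤ → ℂ := fun m =>
    -(1 / Real.pi : ℂ) * Complex.exp (Complex.I * ((m * τ 0 : ℝ) : ℂ)) with hw
  set f : (Fin 2 → ℕ) → ℤ → ℂ := fun M m =>
    if m ∈ Finset.Icc (-(M 0 : ℤ)) (M 0) then w m * S m (M 1) else 0 with hf
  set C : ℝ := 16 * ∑' n : ℤ, (1 + (n : ℝ) ^ 2) ^ (-(3 / 4) : ℝ) + 2 with hC
  set d : ℝ := ‖1 - Complex.exp (Complex.I * (τ 1 : ℝ))‖ with hd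
  have hd0 : 0 < d := norm_pos_iff.2 (sub_ne_zero.2 hτ.symm)
  have hC0 : 0 ≤ C := by
    have : 0 ≤ ∑' n : ℤ, (1 + (n : ℝ) ^ 2) ^ (-(3 / 4) : ℝ) := tsum_nonneg fun n => by positivity
    positivity
  have hSb : ∀ m N, ‖S m N‖ ≤ C / d * |(m : ℝ)| ^ (-(3 / 2) : ℝ) := by
    intro m N
    rcases eq_or_ne m 0 with rfl | hm
    · simp [hS, profile_zero_left]
    · have h1 : (1 : ℝ) ≤ |(m : ℝ)| := by exact_mod_cast Int.one_le_abs hm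
      have := norm_profile_sum_le h1 (τ 1) N
      rw [div_mul_eq_mul_div, le_div_iff₀ hd0, mul_comm]
      exact this
  have hwn : ∀ m, ‖w m‖ = 1 / Real.pi := by
    intro m
    simp only [hw]
    rw [norm_mul, norm_exp_mul_I_eq_one, mul_one, norm_neg, norm_div, Complex.norm_real,
      Real.norm_of_nonneg Real.pi_pos.le, norm_one]
  have hfs : ∀ M, ∑' m, f M m = fourierPartialSum (latticeBox M) τ := by
    intro M
    rw [fourierPartialSum_latticeBox, tsum_eq_sum (s := Finset.Icc (-(M 0 : ℤ)) (M 0))]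
    · refine Finset.sum_congr rfl fun m hm => ?_
      simp only [hf, if_pos hm]
      rfl
    · intro m hm
      simp only [hf, if_neg hm]
  simp_rw [← hfs]
  -- Both truncations are encoded in `f M`, extended by zero, so one dominated limit treats `M₁` and
  -- `M₂` independently.
  refine tendsto_tsum_of_dominated_convergence
    (bound := fun m => 1 / Real.pi * (C / d * |(m : ℝ)| ^ (-(3 / 2) : ℝ))) ?_ ?_ ?_
  · exact ((Real.summable_abs_int_rpow (by norm_num)).mul_left _).mul_left _
  · intro m
    have h1 : Tendsto (fun M : Fin 2 → ℕ => w m * S m (M 1)) atTop (𝓝 (w m * L m)) :=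
      (((hL m).comp (Finset.tendsto_Icc_neg (R := ℤ))).comp (tendsto_apply_atTop 1)).const_mul _
    refine h1.congr' ?_
    filter_upwards [((Finset.tendsto_Icc_neg (R := ℤ)).comp (tendsto_apply_atTop 0)).eventually
      (eventually_ge_atTop {m})] with M hM
    have : m ∈ Finset.Icc (-(M 0 : ℤ)) (M 0) := hM (Finset.mem_singleton_self m)
    simp only [hf, if_pos this]
  · refine Eventually.of_forall fun M m => ?_
    simp only [hf]
    split_ifs
    · rw [norm_mul, hwn]
      exact mul_le_mul_of_nonneg_left (hSb m _) (by positivity)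
    · rw [norm_zero]; positivity

/-- `profile` is odd in its second argument. This covers the line where the factor `1 - e^{iy}`
degenerates. -/
theorem fourierPartialSum_latticeBox_eq_zero (M : Fin 2 → ℕ) {τ : Plane} (hτ : τ 1 = 0) :
    fourierPartialSum (latticeBox M) τ = 0 := by
  rw [fourierPartialSum_latticeBox]
  refine Finset.sum_eq_zero fun m _ => ?_
  rw [mul_eq_zero]
  right
  have h : ∀ N : ℕ, ∑ n ∈ Finset.Icc (-(N : ℤ)) N, (profile m n : ℂ) =
      -∑ n ∈ Finset.Icc (-(N : ℤ)) N, (profile m n : ℂ) := by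
    intro N
    rw [← Finset.sum_neg_distrib]
    refine Finset.sum_nbij' (fun n => -n) (fun n => -n) ?_ ?_ ?_ ?_ ?_
    · intro n; simp only [Finset.mem_Icc]; omega
    · intro n; simp only [Finset.mem_Icc]; omega
    · intro n _; simp
    · intro n _; simp
    · intro n _
      simp only [profile]
      push_cast
      ring
  simp only [hτ, mul_zero, Complex.ofReal_zero, Complex.exp_zero, mul_one]
  exact self_eq_neg.1 (h _)

/-! ### Closed form of the symbol by geometric series. -/

theorem cosh_sub_cos_pos (x : ℝ) {t : ℝ} (ht : t ≠ 0) : 0 < Real.cosh t - Real.cos x := by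
  have := Real.one_lt_cosh.2 ht
  linarith [Real.cos_le_one x]

/-- The function `t / (cosh t - c)`, whose values at the translates of `y` sum up to the symbol. -/
noncomputable def quotientProfile (c t : ℝ) : ℝ := t / (Real.cosh t - c)

theorem hasSum_sign_mul_exp (x : ℝ) {t : ℝ} (ht : t ≠ 0) :
    HasSum (fun m : ℤ => Complex.exp (Complex.I * ((m * x : ℝ) : ℂ)) *
        ((m.sign : ℝ) * Real.exp (-|(m : ℝ)| * |t|) : ℝ))
      (Complex.I * (Real.sin x / (Real.cosh t - Real.cos x) : ℝ)) := by
  have ht' : 0 < |t| := abs_pos.2 ht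
  set q : ℂ := Complex.exp (Complex.I * x - |t|) with hq
  set r : ℂ := Complex.exp (-(Complex.I * x) - |t|) with hr
  have hqn : ‖q‖ < 1 := by
    rw [hq, Complex.norm_exp]; simpa using ht
  have hrn : ‖r‖ < 1 := by
    rw [hr, Complex.norm_exp]; simpa using ht
  -- The term `m = 0` is removed because its sign is zero; the negative indices start at `-1`,
  -- whence the extra factor `r` in `h2`.
  have h1 := (hasSum_geometric_of_norm_lt_one hqn).sub (hasSum_ite_eq (0 : ℕ) (1 : ℂ))
  have h2 := ((hasSum_geometric_of_norm_lt_one hrn).mul_left r).neg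
  convert! HasSum.of_nat_of_neg_add_one (m := (1 - q)⁻¹ - 1) (m' := -(r * (1 - r)⁻¹)) ?_ ?_ using 1
  · have hd := (cosh_sub_cos_pos x ht).ne'
    have h3 : (1 - q) * (1 - r) = 2 * Complex.exp (-(|t| : ℝ)) *
        ((Real.cosh t - Real.cos x : ℝ) : ℂ) := by
      have e1 : q * r = Complex.exp (-(|t| : ℝ)) * Complex.exp (-(|t| : ℝ)) := by
        rw [hq, hr, ← Complex.exp_add, ← Complex.exp_add]; ring_nf
      have e2 : q + r = 2 * Complex.exp (-(|t| : ℝ)) * Complex.cos x := by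
        rw [hq, hr, Complex.cos, sub_eq_add_neg, sub_eq_add_neg, Complex.exp_add, Complex.exp_add]
        rw [mul_comm (x : ℂ) Complex.I, neg_mul, mul_comm (x : ℂ)]
        ring
      have e3 : 1 + Complex.exp (-(|t| : ℝ)) * Complex.exp (-(|t| : ℝ)) =
          2 * Complex.exp (-(|t| : ℝ)) * Complex.cosh (|t| : ℝ) := by
        rw [Complex.cosh]
        have : Complex.exp (|t| : ℝ) * Complex.exp (-(|t| : ℝ)) = 1 := by
          rw [← Complex.exp_add]; simp
        linear_combination -this
      rw [← Real.cosh_abs]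
      push_cast
      linear_combination e1 - e2 + e3
    have h4 : q - r = 2 * Complex.exp (-(|t| : ℝ)) * (Complex.I * Complex.sin x) := by
      rw [hq, hr, Complex.sin, sub_eq_add_neg (Complex.I * (x : ℂ)), sub_eq_add_neg (-(_ : ℂ)),
        Complex.exp_add, Complex.exp_add]
      rw [mul_comm (x : ℂ) Complex.I, neg_mul, mul_comm (x : ℂ)]
      linear_combination (-Complex.exp (-(|t| : ℝ)) *
        (Complex.exp (-(Complex.I * x)) - Complex.exp (Complex.I * x))) * Complex.I_sq
    have hq1 : 1 - q ≠ 0 := by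
      intro h
      rw [← sub_eq_zero.1 h] at hqn
      simp at hqn
    have hr1 : 1 - r ≠ 0 := by
      intro h
      rw [← sub_eq_zero.1 h] at hrn
      simp at hrn
    have h5 : (1 - q)⁻¹ - 1 + -(r * (1 - r)⁻¹) = (q - r) / ((1 - q) * (1 - r)) := by
      field_simp
      ring
    have hE := Complex.exp_ne_zero (-(|t| : ℝ))
    have hd' : ((Real.cosh t - Real.cos x : ℝ) : ℂ) ≠ 0 := by exact_mod_cast hd
    rw [h5, h3, h4, Complex.ofReal_div, Complex.ofReal_sin]
    field_simp
  · refine h1.congr_fun ?_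
    intro n
    rcases eq_or_ne n 0 with rfl | hn
    · simp
    · rw [if_neg hn, sub_zero, hq, ← Complex.exp_nat_mul,
        Int.sign_eq_one_of_pos (by omega)]
      push_cast
      rw [one_mul, ← Complex.exp_add]
      simp
      ring_nf
  · refine h2.congr_fun ?_
    intro n
    rw [← pow_succ', hr, ← Complex.exp_nat_mul, Int.sign_eq_neg_one_of_neg (by omega)]
    have : |(((-((n : ℤ) + 1) : ℤ)) : ℝ)| = n + 1 := by
      push_cast
      rw [abs_neg, abs_of_nonneg (by positivity)]
    rw [this]
    push_cast
    rw [neg_one_mul, mul_neg, ← Complex.exp_add]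
    ring_nf

/-- Oddness of `profile` in its first argument extends Poisson summation to negative `m` and
accounts for the sign; for `m = 0` both sides vanish. -/
theorem hasSum_profile_int_mul_exp (m : ℤ) (y : ℝ) :
    HasSum (fun n : ℤ => (profile m n : ℂ) * Complex.exp (Complex.I * ((n * y : ℝ) : ℂ)))
      (Real.pi * Complex.I / 2 * ∑' k : ℤ,
        (((m.sign : ℝ) * (translate y k * Real.exp (-|(m : ℝ)| * |translate y k|)) : ℝ) : ℂ)) := by
  rcases lt_trichotomy m 0 with hm | rfl | hm
  · have h1 : (1 : ℝ) ≤ -(m : ℝ) := by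
      have : (1 : ℤ) ≤ -m := by omega
      exact_mod_cast this
    have h2 := (hasSum_profile_mul_exp h1 y).neg
    rw [Int.sign_eq_neg_one_of_neg hm, abs_of_neg (show (m : ℝ) < 0 by linarith)]
    convert! h2 using 1
    · ext n
      simp only [profile]
      push_cast
      ring
    · rw [← mul_neg, ← tsum_neg]
      congr 1
      refine tsum_congr fun k => ?_
      push_cast
      ring
  · simp [profile_zero_left]
  · have h1 : (1 : ℝ) ≤ (m : ℝ) := by exact_mod_cast hm
    have h2 := hasSum_profile_mul_exp h1 y
    rw [Int.sign_eq_one_of_pos hm, abs_of_pos (show 0 < (m : ℝ) by linarith)]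
    simpa using h2

theorem le_abs_translate {y : ℝ} (hy : |y| ≤ Real.pi) {k : ℤ} (hk : k ≠ 0) :
    Real.pi * |(k : ℝ)| ≤ |translate y k| := by
  have h1 : (1 : ℝ) ≤ |(k : ℝ)| := by exact_mod_cast Int.one_le_abs hk
  have hpi := Real.pi_pos
  have h2 : |2 * Real.pi * k| = 2 * Real.pi * |(k : ℝ)| := by
    rw [abs_mul, abs_of_pos (by positivity)]
  have h3 := abs_sub_abs_le_abs_sub (2 * Real.pi * k) (-y)
  rw [sub_neg_eq_add, abs_neg, add_comm (2 * Real.pi * (k : ℝ)) y] at h3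
  rw [translate]
  nlinarith

theorem abs_le_abs_translate {y : ℝ} (hy : |y| ≤ Real.pi) (k : ℤ) : |y| ≤ |translate y k| := by
  rcases eq_or_ne k 0 with rfl | hk
  · simp [translate]
  · have h1 : (1 : ℝ) ≤ |(k : ℝ)| := by exact_mod_cast Int.one_le_abs hk
    have hpi := Real.pi_pos
    nlinarith [le_abs_translate hy hk]

theorem summable_abs_translate_mul_exp {y : ℝ} (hy : |y| ≤ Real.pi) :
    Summable fun k : ℤ => |translate y k| * Real.exp (-|translate y k|) := by
  refine Summable.of_norm_bounded_eventually (g := fun k : ℤ => 6 * |(k : ℝ)| ^ (-2 : ℝ))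
    ((Real.summable_abs_int_rpow (by norm_num)).mul_left _) ?_
  refine (Set.finite_singleton (0 : ℤ)).subset ?_
  intro k hk
  by_contra h
  apply hk
  have h' : (0 : ℝ) < |(k : ℝ)| := abs_pos.2 (by exact_mod_cast h)
  change ‖|translate y k| * Real.exp (-|translate y k|)‖ ≤ 6 * |(k : ℝ)| ^ (-2 : ℝ)
  rw [Real.norm_of_nonneg (by positivity)]
  have h1 := abs_mul_exp_neg_le one_pos (translate y k)
  rw [neg_one_mul, one_pow, div_one] at h1
  refine h1.trans ?_
  gcongr 6 * ?_
  refine Real.rpow_le_rpow_of_nonpos h' ?_ (by norm_num)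
  have := le_abs_translate hy (k := k) h
  nlinarith [Real.pi_gt_three]

theorem summable_exp_neg_abs_mul {δ : ℝ} (hδ : 0 < δ) :
    Summable fun m : ℤ => Real.exp (-|(m : ℝ)| * δ) := by
  have h : Summable fun n : ℕ => Real.exp (-|(n : ℝ)| * δ) := by
    have := Real.summable_exp_nat_mul_iff.2 (neg_lt_zero.2 hδ)
    refine this.congr fun n => ?_
    rw [abs_of_nonneg (Nat.cast_nonneg n)]
    ring_nf
  refine Summable.of_nat_of_neg ?_ ?_
  · simpa using h
  · simpa using h

theorem tendsto_fourierPartialSum_latticeBox {τ : Plane} (h0 : τ 1 ≠ 0)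
    (hy : |τ 1| ≤ Real.pi) :
    Tendsto (fun M : Fin 2 → ℕ => fourierPartialSum (latticeBox M) τ) atTop
      (𝓝 ((Real.sin (τ 0) / 2 *
        ∑' k : ℤ, quotientProfile (Real.cos (τ 0)) (translate (τ 1) k) : ℝ) : ℂ)) := by
  have hpi := Real.pi_pos
  set x := τ 0 with hx
  set y := τ 1 with hy'
  have hδ : 0 < |y| := abs_pos.2 h0
  have hexp : Complex.exp (Complex.I * (y : ℝ)) ≠ 1 := by
    intro h
    obtain ⟨n, hn⟩ := Complex.exp_eq_one_iff.1 h
    have h2 : y = n * (2 * Real.pi) := by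
      have := congrArg Complex.im hn
      simpa using this
    have hn0 : n ≠ 0 := by
      rintro rfl
      simp at h2
      exact h0 h2
    have h1 : (1 : ℝ) ≤ |(n : ℝ)| := by exact_mod_cast Int.one_le_abs hn0
    rw [h2, abs_mul, abs_of_pos (show 0 < 2 * Real.pi by positivity)] at hy
    nlinarith
  have key := tendsto_fourierPartialSum_latticeBox_tsum τ hexp _
    (fun m => hasSum_profile_int_mul_exp m y)
  rw [← hx] at key
  convert key using 2
  set G : ℤ → ℤ → ℂ := fun m k => -Complex.I / 2 * (translate y k) *
    (Complex.exp (Complex.I * ((m * x : ℝ) : ℂ)) *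
      ((m.sign : ℝ) * Real.exp (-|(m : ℝ)| * |translate y k|) : ℝ)) with hG
  have hGm : ∀ m : ℤ, -(1 / Real.pi : ℂ) * Complex.exp (Complex.I * ((m * x : ℝ) : ℂ)) *
      (Real.pi * Complex.I / 2 * ∑' k : ℤ, (((m.sign : ℝ) *
        (translate y k * Real.exp (-|(m : ℝ)| * |translate y k|)) : ℝ) : ℂ)) = ∑' k, G m k := by
    intro m
    rw [← tsum_mul_left, ← tsum_mul_left]
    refine tsum_congr fun k => ?_
    have : (Real.pi : ℂ) ≠ 0 := by exact_mod_cast hpi.ne'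
    simp only [hG]
    push_cast
    field_simp
  have hGk : ∀ k : ℤ, ∑' m, G m k =
      ((Real.sin x / 2 * quotientProfile (Real.cos x) (translate y k) : ℝ) : ℂ) := by
    intro k
    have ht : translate y k ≠ 0 := abs_pos.1 (hδ.trans_le (abs_le_abs_translate hy k))
    simp only [hG]
    rw [((hasSum_sign_mul_exp x ht).mul_left _).tsum_eq, quotientProfile]
    push_cast
    linear_combination (-(translate y k : ℂ) / 2 *
      (Complex.sin x / (Complex.cosh (translate y k) - Complex.cos x))) * Complex.I_sq
  -- Joint absolute summability permits exchanging the sums over `m` and `k`.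
  have hsum : Summable (Function.uncurry G) := by
    have hb := ((summable_exp_neg_abs_mul hδ).mul_left (Real.exp |y|)).mul_of_nonneg
      (summable_abs_translate_mul_exp hy) (fun m => by positivity) (fun k => by positivity)
    refine Summable.of_norm_bounded hb ?_
    rintro ⟨m, k⟩
    simp only [Function.uncurry, hG]
    rw [norm_mul, norm_mul, norm_mul, norm_exp_mul_I_eq_one, one_mul, Complex.norm_real,
      Complex.norm_real, norm_mul, Real.norm_of_nonneg (Real.exp_pos _).le, norm_div, norm_neg,
      Complex.norm_I, Complex.norm_ofNat, Real.norm_eq_abs, Real.norm_eq_abs]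
    rcases eq_or_ne m 0 with rfl | hm
    · simp
      positivity
    · have h1 : (1 : ℝ) ≤ |(m : ℝ)| := by exact_mod_cast Int.one_le_abs hm
      have hs : |(m.sign : ℝ)| ≤ 1 := by
        rcases Int.sign_trichotomy m with h | h | h <;> simp [h]
      have h2 := abs_le_abs_translate hy k
      -- Decay in both indices comes from `|m||t| ≥ (|m| - 1)|y| + |t|`, valid for `|m| ≥ 1` and
      -- `|t| ≥ |y|`.
      have h3 : Real.exp (-|(m : ℝ)| * |translate y k|) ≤
          Real.exp |y| * Real.exp (-|(m : ℝ)| * |y|) * Real.exp (-|translate y k|) := by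
        rw [← Real.exp_add, ← Real.exp_add, Real.exp_le_exp]
        nlinarith
      calc 1 / 2 * |translate y k| * (|(m.sign : ℝ)| * Real.exp (-|(m : ℝ)| * |translate y k|))
          ≤ 1 * |translate y k| * (1 * (Real.exp |y| * Real.exp (-|(m : ℝ)| * |y|) *
            Real.exp (-|translate y k|))) := by
            gcongr
            norm_num
        _ = _ := by ring
  simp_rw [hGm]
  rw [← hsum.tsum_comm]
  simp_rw [hGk]
  rw [← Complex.ofReal_tsum, tsum_mul_left]

/-! ### The bound `1/2` for the symbol. -/

theorem quotientProfile_neg (c t : ℝ) : quotientProfile c (-t) = -quotientProfile c t := by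
  rw [quotientProfile, quotientProfile, Real.cosh_neg, neg_div]

/-- Rests on `t ≤ sinh t` and the identity `(cosh t - cos x)² - sin² x sinh² t = (1 - cos x cosh
t)²`. -/
theorem abs_sin_mul_quotientProfile_le (x : ℝ) {t : ℝ} (ht : 0 < t) :
    |Real.sin x| * quotientProfile (Real.cos x) t ≤ 1 := by
  have hd := cosh_sub_cos_pos x ht.ne'
  have hs := Real.self_le_sinh_iff.2 ht.le
  have h1 : |Real.sin x| * Real.sinh t ≤ Real.cosh t - Real.cos x := by
    refine abs_le_of_sq_le_sq' ?_ hd.le |>.2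
    rw [mul_pow, sq_abs]
    nlinarith [Real.sin_sq_add_cos_sq x, Real.cosh_sq t, sq_nonneg (1 - Real.cos x * Real.cosh t)]
  rw [quotientProfile, ← mul_div_assoc, div_le_one hd]
  exact (mul_le_mul_of_nonneg_left hs (abs_nonneg _)).trans h1

/-- The tangent-line bound for `cosh` at `a` reduces the claim to `cosh a - cos x ≤ a sinh a`, which
`cosh a + 1 ≤ 3 sinh a` supplies for `a ≥ 3`. -/
theorem quotientProfile_antitone (x : ℝ) {a b : ℝ} (ha : 3 ≤ a) (hab : a ≤ b) :
    quotientProfile (Real.cos x) b ≤ quotientProfile (Real.cos x) a := by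
  have hda := cosh_sub_cos_pos x (show a ≠ 0 by linarith)
  have hdb := cosh_sub_cos_pos x (show b ≠ 0 by linarith)
  rw [quotientProfile, quotientProfile, div_le_div_iff₀ hdb hda]
  have hc := Real.neg_one_le_cos x
  have h1 : Real.cosh a + Real.sinh a * (b - a) ≤ Real.cosh b := by
    have e : Real.cosh b = Real.cosh a * Real.cosh (b - a) + Real.sinh a * Real.sinh (b - a) := by
      rw [← Real.cosh_add]; ring_nf
    have h2 := Real.one_le_cosh (b - a)
    have h3 : b - a ≤ Real.sinh (b - a) := Real.self_le_sinh_iff.2 (by linarith)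
    have h4 : 0 ≤ Real.sinh a := Real.sinh_nonneg_iff.2 (by linarith)
    rw [e]
    nlinarith [Real.cosh_pos a]
  have h5 : Real.cosh a + 1 ≤ a * Real.sinh a := by
    have h6 := Real.add_one_le_exp a
    have h7 : Real.exp (-a) ≤ 1 := Real.exp_le_one_iff.2 (by linarith)
    have h8 : 3 * Real.sinh a ≤ a * Real.sinh a :=
      mul_le_mul_of_nonneg_right ha (Real.sinh_nonneg_iff.2 (by linarith))
    refine le_trans ?_ h8
    rw [Real.cosh_eq, Real.sinh_eq]
    linarith
  nlinarith [mul_le_mul_of_nonneg_left h1 (show 0 ≤ a by linarith),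
    mul_le_mul_of_nonneg_left h5 (show 0 ≤ b - a by linarith),
    mul_le_mul_of_nonneg_left hc (show 0 ≤ b - a by linarith)]

/-- Since `|t_k| ≥ |y|`, the denominator is at least `(1 - 1/cosh y) cosh t_k`, so the terms are
dominated by `|t_k| e^{-|t_k|}`. -/
theorem summable_quotientProfile_translate (x : ℝ) {y : ℝ} (h0 : y ≠ 0) (hy : |y| ≤ Real.pi) :
    Summable fun k : ℤ => quotientProfile (Real.cos x) (translate y k) := by
  have hpos := cosh_sub_cos_pos x h0
  set d := Real.cosh y - 1 with hd
  have hd0 : 0 < d := by have := Real.one_lt_cosh.2 h0; linarith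
  have hch := Real.cosh_pos y
  refine Summable.of_norm_bounded
    ((summable_abs_translate_mul_exp hy).mul_left (2 * Real.cosh y / d)) ?_
  intro k
  set t := translate y k with ht
  have hyt : Real.cosh y ≤ Real.cosh t := Real.cosh_le_cosh.2 (abs_le_abs_translate hy k)
  have ht0 : t ≠ 0 := abs_pos.1 ((abs_pos.2 h0).trans_le (abs_le_abs_translate hy k))
  have h1 := cosh_sub_cos_pos x ht0
  rw [quotientProfile, norm_div, Real.norm_eq_abs, Real.norm_of_nonneg h1.le, Real.exp_neg,
    div_le_iff₀ h1]
  have h2 : Real.exp |t| ≤ 2 * Real.cosh t := by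
    rw [← Real.cosh_abs, Real.cosh_eq]
    linarith [Real.exp_pos (-|t|)]
  have h3 : d * Real.cosh t ≤ Real.cosh y * (Real.cosh t - Real.cos x) := by
    rw [hd]
    nlinarith [Real.cos_le_one x]
  have h4 : 1 ≤ 2 * Real.cosh y / d * (Real.exp |t|)⁻¹ * (Real.cosh t - Real.cos x) := by
    rw [← div_eq_mul_inv, div_div, div_mul_eq_mul_div, le_div_iff₀ (by positivity)]
    nlinarith
  nlinarith [abs_nonneg t]

theorem tsum_quotientProfile_translate_bounds (x : ℝ) {y : ℝ} (h0 : 0 < y) (hy : y ≤ Real.pi) :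
    -quotientProfile (Real.cos x) (2 * Real.pi - y) ≤
        ∑' k : ℤ, quotientProfile (Real.cos x) (translate y k) ∧
      ∑' k : ℤ, quotientProfile (Real.cos x) (translate y k) ≤
        quotientProfile (Real.cos x) y := by
  have hpi := Real.pi_gt_three
  have hs := summable_quotientProfile_translate x h0.ne' (by rwa [abs_of_pos h0])
  set f : ℤ → ℝ := fun k => quotientProfile (Real.cos x) (translate y k) with hf
  have hneg : ∀ n : ℕ, f (-((n : ℤ) + 1)) =
      -quotientProfile (Real.cos x) (2 * Real.pi * (n + 1) - y) := by
    intro n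
    simp only [hf]
    rw [← quotientProfile_neg, translate]
    push_cast
    ring_nf
  have hnat : ∀ n : ℕ, f n = quotientProfile (Real.cos x) (y + 2 * Real.pi * n) := by
    intro n
    simp [hf, translate]
  have hpos : ∀ t : ℝ, 0 < t → 0 ≤ quotientProfile (Real.cos x) t := fun t ht =>
    div_nonneg ht.le (cosh_sub_cos_pos x ht.ne').le
  constructor
  · have hS := hs.hasSum.nat_add_neg_add_one
    -- For the lower bound `k = n + 1` is paired with `-(n + 2)`: here `y + 2π(n+1) ≤ 2π(n+2) - y`,
    -- so each pair is nonnegative.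
    have h1 : ∑' k, f k = (f 0 + f (-1)) + ∑' n : ℕ, (f ((n + 1 : ℕ) : ℤ) +
        f (-(((n + 1 : ℕ) : ℤ) + 1))) := by
      rw [← hS.tsum_eq, hS.summable.tsum_eq_zero_add]
      simp
    rw [h1]
    have h2 : 0 ≤ ∑' n : ℕ, (f ((n + 1 : ℕ) : ℤ) + f (-(((n + 1 : ℕ) : ℤ) + 1))) := by
      refine tsum_nonneg fun n => ?_
      rw [hneg, hnat, ← sub_eq_add_neg, sub_nonneg]
      push_cast
      have hn : (0 : ℝ) ≤ n := Nat.cast_nonneg n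
      apply quotientProfile_antitone <;> nlinarith
    have h3 : f (-1) = -quotientProfile (Real.cos x) (2 * Real.pi - y) := by
      simpa using hneg 0
    have h4 : 0 ≤ f 0 := by
      have := hnat 0
      simp only [Nat.cast_zero, mul_zero, add_zero] at this
      rw [this]
      exact hpos y h0
    linarith
  · have hp : Summable fun n : ℕ => f ((n : ℤ) + 1) :=
      hs.comp_injective (i := fun n : ℕ => (n : ℤ) + 1) (fun a b h => by simpa using h)
    have hm : Summable fun n : ℕ => f (-((n : ℤ) + 1)) :=
      hs.comp_injective (i := fun n : ℕ => -((n : ℤ) + 1)) (fun a b h => by simpa using h)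
    rw [tsum_of_add_one_of_neg_add_one hp hm]
    -- For the upper bound `n + 1` is paired with `-(n + 1)`; the smallest argument is `2π - y ≥ π >
    -- 3`, within the range of monotonicity.
    have h0' : f 0 = quotientProfile (Real.cos x) y := by simpa using hnat 0
    have h2 : ∑' n : ℕ, f ((n : ℤ) + 1) ≤ ∑' n : ℕ, -f (-((n : ℤ) + 1)) := by
      refine hp.tsum_le_tsum (fun n => ?_) hm.neg
      have h3 := hnat (n + 1)
      push_cast at h3
      rw [hneg, neg_neg, h3]
      have hn : (0 : ℝ) ≤ n := Nat.cast_nonneg n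
      apply quotientProfile_antitone <;> nlinarith
    rw [tsum_neg] at h2
    linarith

theorem translate_neg (y : ℝ) (k : ℤ) : translate (-y) k = -translate y (-k) := by
  simp [translate]
  ring

theorem abs_sin_mul_tsum_quotientProfile_le (x : ℝ) {y : ℝ} (h0 : y ≠ 0) (hy : |y| ≤ Real.pi) :
    |Real.sin x * ∑' k : ℤ, quotientProfile (Real.cos x) (translate y k)| ≤ 1 := by
  wlog hpos : 0 < y generalizing y
  · have h1 := this (neg_ne_zero.2 h0) (by rwa [abs_neg])
      (neg_pos.2 (lt_of_le_of_ne (not_lt.1 hpos) h0))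
    have h2 : ∑' k : ℤ, quotientProfile (Real.cos x) (translate (-y) k) =
        -∑' k : ℤ, quotientProfile (Real.cos x) (translate y k) := by
      simp_rw [translate_neg, quotientProfile_neg, tsum_neg]
      congr 1
      exact (Equiv.neg ℤ).tsum_eq fun k => quotientProfile (Real.cos x) (translate y k)
    rwa [h2, mul_neg, abs_neg] at h1
  · rw [abs_of_pos hpos] at hy
    obtain ⟨h1, h2⟩ := tsum_quotientProfile_translate_bounds x hpos hy
    have h3 := abs_sin_mul_quotientProfile_le x hpos
    have h4 := abs_sin_mul_quotientProfile_le x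
      (show 0 < 2 * Real.pi - y by linarith [Real.pi_pos])
    have h5 := abs_nonneg (Real.sin x)
    rw [abs_mul, ← abs_of_nonneg h5, ← abs_mul, abs_le]
    constructor <;> nlinarith

theorem tendsto_symbol {τ : Plane} (hτ : τ ∈ periodSquare) :
    Tendsto (fun M : Fin 2 → ℕ => fourierPartialSum (latticeBox M) τ) atTop (𝓝 (symbol τ)) ∧
      symbol τ ∈ idealSet := by
  have hy : |τ 1| ≤ Real.pi := abs_le.2 (hτ 1)
  have hex : ∃ r : ℝ, |r| ≤ 1 / 2 ∧
      Tendsto (fun M : Fin 2 → ℕ => fourierPartialSum (latticeBox M) τ) atTop (𝓝 (r : ℂ)) := by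
    rcases eq_or_ne (τ 1) 0 with h0 | h0
    · refine ⟨0, by norm_num, ?_⟩
      simp_rw [fourierPartialSum_latticeBox_eq_zero _ h0, Complex.ofReal_zero]
      exact tendsto_const_nhds
    · refine ⟨_, ?_, tendsto_fourierPartialSum_latticeBox h0 hy⟩
      rw [div_mul_eq_mul_div, abs_div, abs_two]
      have := abs_sin_mul_tsum_quotientProfile_le (τ 0) h0 hy
      linarith
  obtain ⟨r, hr, hlim⟩ := hex
  -- `limUnder` carries information only once a limit is known to exist, so convergence to an
  -- explicit real number comes first.
  have hsym : symbol τ = r := hlim.limUnder_eq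
  rw [hsym]
  refine ⟨hlim, r, ?_, rfl⟩
  have := abs_le.1 hr
  constructor <;> linarith

/-! ### The Fourier series in `L²(Q)`. -/

/-- The character `τ ↦ e^{i m·τ}`. -/
noncomputable def character (m : Fin 2 → ℤ) (τ : Plane) : ℂ :=
  Complex.exp (Complex.I * ((∑ i, (m i : ℝ) * τ i : ℝ) : ℂ))

theorem norm_character (m : Fin 2 → ℤ) (τ : Plane) : ‖character m τ‖ = 1 :=
  norm_exp_mul_I_eq_one _

@[fun_prop]
theorem continuous_character (m : Fin 2 → ℤ) : Continuous (character m) := by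
  unfold character
  fun_prop

theorem conj_character_mul (m n : Fin 2 → ℤ) (τ : Plane) :
    star (character m τ) * character n τ = character (n - m) τ := by
  simp only [character, Complex.star_def]
  rw [← Complex.exp_conj, ← Complex.exp_add, map_mul, Complex.conj_I, Complex.conj_ofReal]
  congr 1
  simp only [Fin.sum_univ_two, Pi.sub_apply]
  push_cast
  ring

/-- Lebesgue measure on the period square. -/
noncomputable abbrev periodMeasure : Measure Plane := volume.restrict periodSquare

theorem periodSquare_eq_preimage :
    periodSquare = (WithLp.ofLp : Plane → Fin 2 → ℝ) ⁻¹'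
      (Set.univ.pi fun _ => Set.Icc (-Real.pi) Real.pi) := by
  ext τ
  simp only [periodSquare, Set.mem_ofPred_eq, Set.mem_preimage, Set.mem_univ_pi]

theorem measurableSet_periodSquare : MeasurableSet periodSquare := by
  rw [periodSquare_eq_preimage]
  exact (WithLp.measurable_ofLp 2 (Fin 2 → ℝ))
    (MeasurableSet.univ_pi fun _ => measurableSet_Icc)

theorem isBounded_periodSquare : Bornology.IsBounded periodSquare := by
  refine (Metric.isBounded_iff_subset_closedBall 0).2 ⟨Real.pi + Real.pi, fun τ hτ => ?_⟩
  rw [mem_closedBall_zero_iff]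
  have h0 := abs_le.2 (hτ 0)
  have h1 := abs_le.2 (hτ 1)
  rw [EuclideanSpace.norm_eq, Fin.sum_univ_two]
  refine Real.sqrt_le_iff.2 ⟨by positivity, ?_⟩
  rw [Real.norm_eq_abs, Real.norm_eq_abs]
  nlinarith [abs_nonneg (τ 0), abs_nonneg (τ 1), Real.pi_pos]

instance : IsFiniteMeasure periodMeasure :=
  ⟨by rw [Measure.restrict_apply_univ]; exact isBounded_periodSquare.measure_lt_top⟩

theorem integral_exp_int_mul (k : ℤ) :
    ∫ t in Set.Icc (-Real.pi) Real.pi, Complex.exp (Complex.I * k * t) =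
      if k = 0 then (2 * Real.pi : ℂ) else 0 := by
  rw [integral_Icc_eq_integral_Ioc,
    ← intervalIntegral.integral_of_le (by linarith [Real.pi_pos])]
  split_ifs with hk
  · simp [hk]
    ring
  · have hc : Complex.I * (k : ℂ) ≠ 0 := mul_ne_zero Complex.I_ne_zero (by exact_mod_cast hk)
    rw [integral_exp_mul_complex hc, div_eq_zero_iff]
    left
    rw [sub_eq_zero, Complex.exp_eq_exp_iff_exists_int]
    exact ⟨k, by push_cast; ring⟩

theorem integral_character (m : Fin 2 → ℤ) :
    ∫ τ, character m τ ∂periodMeasure = if m = 0 then ((2 * Real.pi) ^ 2 : ℂ) else 0 := by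
  have h1 : ∀ τ : Plane, character m τ =
      (fun v : Fin 2 → ℝ => ∏ i, Complex.exp (Complex.I * (m i : ℂ) * (v i : ℝ))) τ.ofLp := by
    intro τ
    simp only [character]
    rw [← Complex.exp_sum]
    congr 1
    simp only [Fin.sum_univ_two]
    push_cast
    ring
  have h2 := (PiLp.volume_preserving_ofLp (Fin 2)).setIntegral_preimage_emb
    (MeasurableEquiv.toLp 2 (Fin 2 → ℝ)).symm.measurableEmbedding
    (fun v : Fin 2 → ℝ => ∏ i, Complex.exp (Complex.I * (m i : ℂ) * (v i : ℝ)))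
    (Set.univ.pi fun _ => Set.Icc (-Real.pi) Real.pi)
  rw [integral_congr_ae (Eventually.of_forall h1), periodMeasure, periodSquare_eq_preimage]
  refine h2.trans ?_
  rw [volume_pi,
    Measure.restrict_pi_pi, integral_fintype_prod_eq_prod
      (fun i (t : ℝ) => Complex.exp (Complex.I * (m i : ℂ) * (t : ℝ)))]
  simp_rw [integral_exp_int_mul]
  rw [Fin.prod_univ_two]
  by_cases h : m = 0
  · simp [h, sq]
  · rw [if_neg h]
    by_cases h0 : m 0 = 0
    · have : m 1 ≠ 0 := fun h' => h (funext (Fin.forall_fin_two.2 ⟨h0, h'⟩))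
      simp [this]
    · simp [h0]

theorem memLp_character (m : Fin 2 → ℤ) : MemLp (character m) 2 periodMeasure :=
  MemLp.of_bound (continuous_character m).aestronglyMeasurable 1
    (Eventually.of_forall fun τ => (norm_character m τ).le)

/-- The normalized characters as elements of `L²(Q)`. -/
noncomputable def characterLp (m : Fin 2 → ℤ) : Lp ℂ 2 periodMeasure :=
  ((2 * Real.pi : ℂ)⁻¹) • (memLp_character m).toLp (character m)

theorem orthonormal_characterLp : Orthonormal ℂ characterLp := by
  rw [orthonormal_iff_ite]
  intro m n
  have hpi : (2 * Real.pi : ℂ) ≠ 0 := by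
    exact_mod_cast (show (2 * Real.pi : ℝ) ≠ 0 by positivity)
  rw [characterLp, characterLp, inner_smul_left, inner_smul_right, L2.inner_def]
  have h : ∫ τ, inner ℂ ((memLp_character m).toLp (character m) τ)
      ((memLp_character n).toLp (character n) τ) ∂periodMeasure =
      ∫ τ, character (n - m) τ ∂periodMeasure := by
    refine integral_congr_ae ?_
    filter_upwards [(memLp_character m).coeFn_toLp, (memLp_character n).coeFn_toLp] with τ h1 h2
    rw [h1, h2, ← conj_character_mul, RCLike.inner_apply, mul_comm]
    rfl
  rw [h, integral_character]
  simp only [sub_eq_zero, eq_comm (a := n)]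
  split_ifs
  · simp only [map_inv₀, map_mul, Complex.conj_ofReal, map_ofNat]
    field_simp
  · simp

/-- Using a different bound for each of the two factors gives a product of summable functions of `m`
and of `n`. -/
theorem profile_sq_le (m n : ℤ) :
    profile m n ^ 2 ≤ |(m : ℝ)| ^ (-(3 / 2) : ℝ) * (1 + (n : ℝ) ^ 2)⁻¹ := by
  rcases eq_or_ne m 0 with rfl | hm
  · simp [profile_zero_left]
  · have h1 : (1 : ℝ) ≤ |(m : ℝ)| := by exact_mod_cast Int.one_le_abs hm
    rw [← sq_abs, sq]
    exact mul_le_mul (abs_profile_le_rpow h1 n) (abs_profile_le h1 n) (abs_nonneg _)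
      (by positivity)

theorem summable_toeplitzCoeff_sq : Summable fun m : Fin 2 → ℤ => toeplitzCoeff m ^ 2 := by
  have h : Summable fun p : ℤ × ℤ => (1 / Real.pi) ^ 2 * profile p.1 p.2 ^ 2 := by
    refine Summable.mul_left _ (Summable.of_nonneg_of_le (fun _ => sq_nonneg _)
      (fun p => profile_sq_le p.1 p.2) ?_)
    exact (Real.summable_abs_int_rpow (by norm_num)).mul_of_nonneg summable_inv_one_add_sq
      (fun _ => by positivity) (fun _ => by positivity)
  have h2 := (finTwoArrowEquiv ℤ).summable_iff.2 h
  refine h2.congr fun m => ?_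
  simp [toeplitzCoeff_eq, mul_pow]

theorem memLp_fourierPartialSum (s : Finset (Fin 2 → ℤ)) :
    MemLp (fourierPartialSum s) 2 periodMeasure := by
  have : fourierPartialSum s = fun τ => ∑ m ∈ s, (toeplitzCoeff m : ℂ) * character m τ := rfl
  rw [this]
  exact memLp_finsetSum s fun m _ => (memLp_character m).const_mul _

theorem toLp_fourierPartialSum (s : Finset (Fin 2 → ℤ)) :
    (memLp_fourierPartialSum s).toLp (fourierPartialSum s) =
      ∑ m ∈ s, (2 * Real.pi * toeplitzCoeff m : ℂ) • characterLp m := by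
  have hpi : (2 * Real.pi : ℂ) ≠ 0 := by
    exact_mod_cast (show (2 * Real.pi : ℝ) ≠ 0 by positivity)
  induction s using Finset.induction_on with
  | empty =>
    rw [Finset.sum_empty, ← MemLp.toLp_zero (μ := periodMeasure) (E := ℂ) (p := 2) MemLp.zero']
    rfl
  | insert m s hm ih =>
    rw [Finset.sum_insert hm, ← ih, characterLp, smul_smul,
      show (2 * Real.pi * toeplitzCoeff m * (2 * (Real.pi : ℂ))⁻¹) = toeplitzCoeff m by field_simp,
      ← MemLp.toLp_const_smul, ← MemLp.toLp_add]
    congr 1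
    ext τ
    simp only [fourierPartialSum, Finset.sum_insert hm]
    rfl

theorem summable_smul_characterLp :
    Summable fun m => (2 * Real.pi * toeplitzCoeff m : ℂ) • characterLp m := by
  have h := (orthonormal_characterLp.orthogonalFamily.summable_iff_norm_sq_summable
    (fun m => (2 * Real.pi * toeplitzCoeff m : ℂ))).2 ?_
  · exact h
  · refine (summable_toeplitzCoeff_sq.mul_left ((2 * Real.pi) ^ 2)).congr fun m => ?_
    rw [← Complex.ofReal_ofNat, ← Complex.ofReal_mul, ← Complex.ofReal_mul, Complex.norm_real,
      Real.norm_eq_abs, sq_abs]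
    ring

/-- The `L²(Q)` sum of the Fourier series. -/
noncomputable def symbolLp : Lp ℂ 2 periodMeasure :=
  ∑' m, (2 * Real.pi * toeplitzCoeff m : ℂ) • characterLp m

/-- The limit runs over all finite index sets, which is unconditional convergence; rectangles are a
cofinal special case. -/
theorem tendsto_eLpNorm_sub_symbolLp :
    Tendsto (fun s => eLpNorm (fourierPartialSum s - ⇑symbolLp) 2 periodMeasure) atTop (𝓝 0) := by
  rw [← Lp.tendsto_Lp_iff_tendsto_eLpNorm'' _ memLp_fourierPartialSum _ (Lp.memLp _)]
  simp_rw [toLp_fourierPartialSum, Lp.toLp_coeFn]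
  exact summable_smul_characterLp.hasSum

theorem tendsto_latticeBox : Tendsto latticeBox atTop atTop := by
  refine tendsto_atTop_finset_of_monotone ?_ ?_
  · intro M N h
    refine Finset.Icc_subset_Icc ?_ ?_ <;> intro i <;> have := h i <;> simp <;> omega
  · intro m
    refine ⟨fun i => (m i).natAbs, Finset.mem_Icc.2 ⟨?_, ?_⟩⟩ <;> intro i
    · simpa using neg_abs_le (m i)
    · simpa using le_abs_self (m i)

/-- `L²` convergence along rectangles gives an a.e. convergent subsequence, whose limit must be the
pointwise one. -/
theorem symbol_ae_eq : symbol =ᵐ[periodMeasure] symbolLp := by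
  have h := tendstoInMeasure_of_tendsto_eLpNorm_of_ne_top (p := 2) two_ne_zero
    ENNReal.ofNat_ne_top (fun M => (memLp_fourierPartialSum (latticeBox M)).aestronglyMeasurable)
    (Lp.aestronglyMeasurable symbolLp) (tendsto_eLpNorm_sub_symbolLp.comp tendsto_latticeBox)
  obtain ⟨ns, hns, hlim⟩ := h.exists_seq_tendsto_ae'
  filter_upwards [hlim, ae_restrict_mem measurableSet_periodSquare] with τ h1 h2
  exact tendsto_nhds_unique ((tendsto_symbol h2).1.comp hns) h1

theorem memLp_symbol : MemLp symbol 2 periodMeasure :=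
  (memLp_congr_ae symbol_ae_eq).2 (Lp.memLp symbolLp)

theorem tendsto_eLpNorm_symbol_sub :
    Tendsto (fun s => eLpNorm (fun τ => symbol τ - fourierPartialSum s τ) 2 periodMeasure)
      atTop (𝓝 0) := by
  refine tendsto_eLpNorm_sub_symbolLp.congr fun s => ?_
  rw [eLpNorm_sub_comm]
  refine eLpNorm_congr_ae ?_
  filter_upwards [symbol_ae_eq] with τ h
  simp [h]

theorem integral_conj_character_mul_symbol (k : Fin 2 → ℤ) :
    ∫ τ, star (character k τ) * symbol τ ∂periodMeasure =
      (2 * Real.pi) ^ 2 * toeplitzCoeff k := by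
  have hpi : (2 * Real.pi : ℂ) ≠ 0 := by
    exact_mod_cast (show (2 * Real.pi : ℝ) ≠ 0 by positivity)
  have h1 : inner ℂ (characterLp k) symbolLp = 2 * Real.pi * toeplitzCoeff k := by
    have hs := (innerSL ℂ (characterLp k)).hasSum summable_smul_characterLp.hasSum
    have hs2 := hasSum_single (f := fun m => innerSL ℂ (characterLp k)
      ((2 * Real.pi * toeplitzCoeff m : ℂ) • characterLp m)) k ?_
    · have := hs.unique hs2
      rw [innerSL_apply_apply] at this
      rw [symbolLp, this, innerSL_apply_apply, inner_smul_right,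
        (orthonormal_iff_ite.1 orthonormal_characterLp) k k, if_pos rfl, mul_one]
    · intro m hm
      rw [innerSL_apply_apply, inner_smul_right,
        (orthonormal_iff_ite.1 orthonormal_characterLp) k m, if_neg hm.symm, mul_zero]
  have h2 : inner ℂ (characterLp k) symbolLp =
      (2 * Real.pi : ℂ)⁻¹ * ∫ τ, star (character k τ) * symbol τ ∂periodMeasure := by
    rw [characterLp, inner_smul_left, L2.inner_def]
    congr 1
    · simp only [map_inv₀, map_mul, Complex.conj_ofReal, map_ofNat]
    · refine integral_congr_ae ?_
      filter_upwards [(memLp_character k).coeFn_toLp, symbol_ae_eq] with τ h1 h2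
      rw [h1, h2, RCLike.inner_apply, mul_comm]
      rfl
  rw [h1] at h2
  field_simp at h2
  rw [← h2]
  ring

/-! ### The Toeplitz quadratic form. -/

/-- Applied with `g = 1` for Parseval and with `g = symbol` for the Toeplitz form. -/
theorem integral_conj_mul_self_mul {ι : Type*} [Fintype ι] (κ : ι → Fin 2 → ℤ) (u : ι → ℂ)
    {g : Plane → ℂ} (hg : Integrable g periodMeasure) :
    ∫ τ, star (∑ n, u n * character (κ n) τ) * (∑ n, u n * character (κ n) τ) * g τ
        ∂periodMeasure =
      ∑ m, ∑ n, star (u m) * u n *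
        ∫ τ, star (character (κ m - κ n) τ) * g τ ∂periodMeasure := by
  have hi : ∀ k, Integrable (fun τ => star (character k τ) * g τ) periodMeasure := by
    intro k
    refine hg.bdd_mul (c := 1) (continuous_character k).star.aestronglyMeasurable ?_
    exact Eventually.of_forall fun τ => by rw [norm_star, norm_character]
  have h1 : ∀ τ, star (∑ n, u n * character (κ n) τ) * (∑ n, u n * character (κ n) τ) * g τ =
      ∑ m, ∑ n, star (u m) * u n * (star (character (κ m - κ n) τ) * g τ) := by
    intro τ
    rw [star_sum, Finset.sum_mul_sum, Finset.sum_mul]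
    refine Finset.sum_congr rfl fun m _ => ?_
    rw [Finset.sum_mul]
    refine Finset.sum_congr rfl fun n _ => ?_
    rw [← conj_character_mul, star_mul', star_mul', star_star]
    ring
  simp_rw [h1]
  rw [integral_finsetSum _ fun m _ => integrable_finsetSum _ fun n _ => (hi _).const_mul _]
  refine Finset.sum_congr rfl fun m _ => ?_
  rw [integral_finsetSum _ fun n _ => (hi _).const_mul _]
  exact Finset.sum_congr rfl fun n _ => integral_const_mul _ _

theorem integral_normSq_sum_character {ι : Type*} [Fintype ι] {κ : ι → Fin 2 → ℤ}
    (hκ : Function.Injective κ) (u : ι → ℂ) :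
    ∫ τ, ‖∑ n, u n * character (κ n) τ‖ ^ 2 ∂periodMeasure =
      (2 * Real.pi) ^ 2 * ∑ n, ‖u n‖ ^ 2 := by
  classical
  have h := integral_conj_mul_self_mul κ u (integrable_const (1 : ℂ))
  have h1 : ∀ k : Fin 2 → ℤ, ∫ τ, star (character k τ) * 1 ∂periodMeasure =
      if k = 0 then ((2 * Real.pi) ^ 2 : ℂ) else 0 := by
    intro k
    have h2 : ∀ τ, star (character k τ) * 1 = character (-k) τ := by
      intro τ
      have := conj_character_mul k 0 τ
      rw [zero_sub] at this
      rw [← this]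
      simp [character]
    simp_rw [h2, integral_character, neg_eq_zero]
  simp_rw [h1, sub_eq_zero, hκ.eq_iff, mul_ite, mul_zero, Finset.sum_ite_eq, Finset.mem_univ,
    if_true, mul_one] at h
  have h3 : ∀ z : ℂ, star z * z = ((‖z‖ ^ 2 : ℝ) : ℂ) := by
    intro z
    rw [Complex.star_def, Complex.conj_mul']
    push_cast
    rfl
  simp_rw [h3] at h
  rw [integral_complex_ofReal, ← Finset.sum_mul] at h
  have h4 := h
  norm_cast at h4
  rw [h4, mul_comm]

/-- The form equals `(2π)^{-2} ∫ |p|² F`; as `F` is real with `|F| ≤ 1/2`, Parseval for `p` bounds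
it. -/
theorem quadraticForm_toeplitzCoeff {ι : Type*} [Fintype ι] {κ : ι → Fin 2 → ℤ}
    (hκ : Function.Injective κ) (u : ι → ℂ) :
    ∃ r : ℝ, |r| ≤ 1 / 2 * ∑ n, ‖u n‖ ^ 2 ∧
      ∑ m, ∑ n, star (u m) * u n * (toeplitzCoeff (κ m - κ n) : ℂ) = r := by
  set p : Plane → ℂ := fun τ => ∑ n, u n * character (κ n) τ with hp
  have hpc : Continuous p := by fun_prop
  have hpi : (0 : ℝ) < (2 * Real.pi) ^ 2 := by positivity
  have hpi' : ((2 * Real.pi) ^ 2 : ℂ) ≠ 0 := by exact_mod_cast hpi.ne'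
  have h := integral_conj_mul_self_mul κ u (memLp_symbol.integrable one_le_two)
  simp_rw [integral_conj_character_mul_symbol] at h
  have hF : ∀ᵐ τ ∂periodMeasure, |(symbol τ).re| ≤ 1 / 2 ∧ symbol τ = ((symbol τ).re : ℂ) := by
    filter_upwards [ae_restrict_mem measurableSet_periodSquare] with τ hτ
    obtain ⟨t, ht, hts⟩ := (tendsto_symbol hτ).2
    rw [← hts]
    simp only [Complex.ofReal_re, and_true]
    rw [abs_le]
    constructor <;> linarith [ht.1, ht.2]
  have h1 : ∫ τ, star (p τ) * p τ * symbol τ ∂periodMeasure =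
      ((∫ τ, ‖p τ‖ ^ 2 * (symbol τ).re ∂periodMeasure : ℝ) : ℂ) := by
    rw [← integral_complex_ofReal]
    refine integral_congr_ae ?_
    filter_upwards [hF] with τ hτ
    rw [Complex.star_def, Complex.conj_mul']
    nth_rewrite 1 [hτ.2]
    push_cast
    rfl
  have hint : Integrable (fun τ => ‖p τ‖ ^ 2) periodMeasure := by
    have hb : ∀ τ, ‖p τ‖ ≤ ∑ n, ‖u n‖ := fun τ =>
      (norm_sum_le _ _).trans (Finset.sum_le_sum fun n _ => by
        rw [norm_mul, norm_character, mul_one])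
    refine Integrable.of_bound (by fun_prop) ((∑ n, ‖u n‖) ^ 2)
      (Eventually.of_forall fun τ => ?_)
    rw [norm_pow, norm_norm]
    gcongr
    exact hb τ
  have h2 : |∫ τ, ‖p τ‖ ^ 2 * (symbol τ).re ∂periodMeasure| ≤
      1 / 2 * ((2 * Real.pi) ^ 2 * ∑ n, ‖u n‖ ^ 2) := by
    rw [← integral_normSq_sum_character hκ, ← integral_const_mul, ← Real.norm_eq_abs]
    refine norm_integral_le_of_norm_le (hint.const_mul _) ?_
    filter_upwards [hF] with τ hτ
    rw [norm_mul, norm_pow, norm_norm, mul_comm, Real.norm_eq_abs]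
    gcongr
    exact hτ.1
  refine ⟨((2 * Real.pi) ^ 2)⁻¹ * ∫ τ, ‖p τ‖ ^ 2 * (symbol τ).re ∂periodMeasure, ?_, ?_⟩
  · rw [abs_mul, abs_of_pos (inv_pos.2 hpi), inv_mul_le_iff₀ hpi]
    linarith
  · rw [Complex.ofReal_mul, ← h1, h]
    push_cast
    rw [Finset.mul_sum]
    refine Finset.sum_congr rfl fun m _ => ?_
    rw [Finset.mul_sum]
    refine Finset.sum_congr rfl fun n _ => ?_
    field_simp

/-! ### The system operator and its resolvent. -/

theorem kernel_smul {c : ℝ} (hc : 0 < c) (x : Plane) : kernel (c • x) = (c ^ 2)⁻¹ * kernel x := by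
  rw [kernel, kernel, norm_smul, Real.norm_of_nonneg hc.le]
  simp only [PiLp.smul_apply, smul_eq_mul]
  rw [show -(c * x 0 * (c * x 1)) = c ^ 2 * -(x 0 * x 1) by ring,
    show Real.pi * (c * ‖x‖) ^ 4 = c ^ 2 * (c ^ 2 * (Real.pi * ‖x‖ ^ 4)) by ring,
    mul_div_mul_left _ _ (by positivity), ← div_div, mul_comm, div_div, mul_comm (c ^ 2),
    ← div_div, div_eq_mul_inv _ (c ^ 2), mul_comm]

theorem gridPoint_sub_gridPoint (a : Plane) (N : ℕ) (m n : Fin 2 → ℤ) :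
    gridPoint a N m - gridPoint a N n = (N : ℝ)⁻¹ • latticePoint (m - n) := by
  rw [gridPoint, gridPoint, add_sub_add_left_eq_sub, ← smul_sub]
  congr 1
  ext i
  simp [latticePoint]

/-- `K` is homogeneous of degree `-2`, so `N^{-2}` cancels and neither `N` nor `a` enters the
entries. -/
theorem systemMatrix_apply (a : Plane) {N : ℕ} (hN : 0 < N) (ω : Finset (Fin 2 → ℤ)) (m n : ω) :
    systemMatrix a N ω m n = (toeplitzCoeff (m - n : Fin 2 → ℤ) : ℂ) := by
  have hN' : (0 : ℝ) < N := by exact_mod_cast hN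
  rw [systemMatrix, Matrix.of_apply, toeplitzCoeff]
  by_cases h : m = n
  · simp [h]
  · have h' : (m - n : Fin 2 → ℤ) ≠ 0 := fun h' => h (Subtype.ext (sub_eq_zero.1 h'))
    rw [if_neg h, if_neg h', gridPoint_sub_gridPoint, kernel_smul (inv_pos.2 hN')]
    congr 1
    field_simp

theorem inner_systemOperator (a : Plane) {N : ℕ} (hN : 0 < N) (ω : Finset (Fin 2 → ℤ))
    (u : EuclideanSpace ℂ ω) :
    ∃ r : ℝ, |r| ≤ 1 / 2 * ‖u‖ ^ 2 ∧ inner ℂ u (systemOperator a N ω u) = r := by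
  obtain ⟨r, hr, hs⟩ := quadraticForm_toeplitzCoeff (κ := fun m : ω => (m : Fin 2 → ℤ))
    Subtype.val_injective u
  refine ⟨r, ?_, ?_⟩
  · rwa [EuclideanSpace.norm_sq_eq]
  · rw [← hs, PiLp.inner_apply, systemOperator, Matrix.ofLp_toEuclideanCLM]
    refine Finset.sum_congr rfl fun m _ => ?_
    rw [RCLike.inner_apply, Matrix.mulVec, dotProduct, Finset.sum_mul]
    refine Finset.sum_congr rfl fun n _ => ?_
    rw [systemMatrix_apply a hN, Complex.star_def]
    ring

theorem idealSet_nonempty : idealSet.Nonempty := ⟨0, 0, by norm_num, by simp⟩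

theorem isClosed_idealSet : IsClosed idealSet :=
  (isCompact_Icc.image Complex.continuous_ofReal).isClosed

/-- Numerical range argument: `⟨u, (z - T)u⟩ = ‖u‖² (z - ρ)` with the Rayleigh quotient `ρ` in
`idealSet`, followed by Cauchy–Schwarz. -/
theorem infDist_mul_norm_le (a : Plane) {N : ℕ} (hN : 0 < N) (ω : Finset (Fin 2 → ℤ)) (z : ℂ)
    (u : EuclideanSpace ℂ ω) :
    Metric.infDist z idealSet * ‖u‖ ≤
      ‖(algebraMap ℂ (EuclideanSpace ℂ ω →L[ℂ] EuclideanSpace ℂ ω) z - systemOperator a N ω) u‖ := by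
  rcases eq_or_ne u 0 with rfl | hu
  · simp
  have hu' : 0 < ‖u‖ := norm_pos_iff.2 hu
  obtain ⟨r, hr, hin⟩ := inner_systemOperator a hN ω u
  set w := (algebraMap ℂ (EuclideanSpace ℂ ω →L[ℂ] EuclideanSpace ℂ ω) z
    - systemOperator a N ω) u with hw
  have h1 : inner ℂ u w = ((‖u‖ ^ 2 : ℝ) : ℂ) * (z - ((r / ‖u‖ ^ 2 : ℝ) : ℂ)) := by
    have hne : (‖u‖ : ℂ) ≠ 0 := by exact_mod_cast hu'.ne'
    rw [hw, sub_apply, ContinuousLinearMap.algebraMap_apply, inner_sub_right,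
      inner_smul_right, hin, inner_self_eq_norm_sq_to_K]
    simp only [Complex.coe_algebraMap]
    push_cast
    field_simp
  have hmem : ((r / ‖u‖ ^ 2 : ℝ) : ℂ) ∈ idealSet := by
    refine ⟨_, ?_, rfl⟩
    have h2 : |r / ‖u‖ ^ 2| ≤ 1 / 2 := by
      rw [abs_div, abs_of_pos (pow_pos hu' 2), div_le_iff₀ (pow_pos hu' 2)]
      exact hr
    constructor <;> linarith [(abs_le.1 h2).1, (abs_le.1 h2).2]
  have h3 : Metric.infDist z idealSet ≤ ‖z - ((r / ‖u‖ ^ 2 : ℝ) : ℂ)‖ := by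
    rw [← dist_eq_norm]
    exact Metric.infDist_le_dist_of_mem hmem
  have h4 := norm_inner_le_norm (𝕜 := ℂ) u w
  rw [h1, norm_mul, Complex.norm_real, Real.norm_of_nonneg (sq_nonneg _)] at h4
  have h5 : ‖u‖ * (Metric.infDist z idealSet * ‖u‖) ≤ ‖u‖ * ‖w‖ := by
    refine le_trans ?_ h4
    nlinarith [mul_le_mul_of_nonneg_left h3 (sq_nonneg ‖u‖)]
  exact le_of_mul_le_mul_left h5 hu'

/-- A lower bound forces injectivity, hence bijectivity in finite dimension, and applied to `A⁻¹ w`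
it becomes the norm bound. -/
theorem isUnit_and_norm_inverse_le {E : Type*} [NormedAddCommGroup E] [NormedSpace ℂ E]
    [FiniteDimensional ℂ E] {A : E →L[ℂ] E} {d : ℝ} (hd : 0 < d)
    (hA : ∀ u, d * ‖u‖ ≤ ‖A u‖) : IsUnit A ∧ ‖Ring.inverse A‖ ≤ d⁻¹ := by
  have : CompleteSpace E := FiniteDimensional.complete ℂ E
  have hinj : Function.Injective A := by
    rw [injective_iff_map_eq_zero]
    intro u hu
    have := hA u
    rw [hu, norm_zero] at this
    exact norm_le_zero_iff.1 (nonpos_of_mul_nonpos_right this hd)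
  have hsurj : Function.Surjective A :=
    LinearMap.injective_iff_surjective (f := (A : E →ₗ[ℂ] E)).1 hinj
  have hunit : IsUnit A := ContinuousLinearMap.isUnit_iff_bijective.2 ⟨hinj, hsurj⟩
  refine ⟨hunit, ContinuousLinearMap.opNorm_le_bound _ (inv_nonneg.2 hd.le) fun w => ?_⟩
  have h1 : A (Ring.inverse A w) = w := by
    have := Ring.mul_inverse_cancel A hunit
    exact congrArg (fun B : E →L[ℂ] E => B w) this
  have h2 := hA (Ring.inverse A w)
  rw [h1] at h2
  rwa [le_inv_mul_iff₀ hd]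

theorem algebraMap_sub_systemOperator_apply (a : Plane) (N : ℕ) (ω : Finset (Fin 2 → ℤ)) (z : ℂ)
    (u : ω → ℂ) (m : ω) :
    (algebraMap ℂ (EuclideanSpace ℂ ω →L[ℂ] EuclideanSpace ℂ ω) z - systemOperator a N ω)
        (WithLp.toLp 2 u) m =
      z * u m - ((N : ℂ) ^ 2)⁻¹ * ∑ n ∈ Finset.univ.erase m,
        (kernel (gridPoint a N m - gridPoint a N n) : ℂ) * u n := by
  rw [sub_apply, ContinuousLinearMap.algebraMap_apply, systemOperator,
    Matrix.toEuclideanCLM_toLp, PiLp.sub_apply, PiLp.smul_apply, smul_eq_mul]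
  congr 1
  change (systemMatrix a N ω).mulVec u m = _
  rw [Matrix.mulVec, dotProduct, ← Finset.sum_erase_add _ _ (Finset.mem_univ m), Finset.mul_sum]
  have h0 : systemMatrix a N ω m m = 0 := by simp [systemMatrix]
  rw [h0, zero_mul, add_zero]
  refine Finset.sum_congr rfl fun n hn => ?_
  rw [systemMatrix, Matrix.of_apply, if_neg (Finset.ne_of_mem_erase hn).symm]
  push_cast
  ring

end DeltaDelta

theorem lemmaL :
    ((∀ τ ∈ DeltaDelta.periodSquare,
        Filter.Tendsto
          (fun M : Fin 2 → ℕ => DeltaDelta.fourierPartialSum (DeltaDelta.latticeBox M) τ)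
          Filter.atTop (nhds (DeltaDelta.symbol τ))) ∧
      MeasureTheory.MemLp DeltaDelta.symbol 2
        (MeasureTheory.volume.restrict DeltaDelta.periodSquare) ∧
      Filter.Tendsto
        (fun s : Finset (Fin 2 → ℤ) =>
          MeasureTheory.eLpNorm
            (fun τ => DeltaDelta.symbol τ - DeltaDelta.fourierPartialSum s τ) 2
            (MeasureTheory.volume.restrict DeltaDelta.periodSquare))
        Filter.atTop (nhds 0) ∧
      ∀ τ ∈ DeltaDelta.periodSquare, DeltaDelta.symbol τ ∈ DeltaDelta.idealSet) ∧
    ∀ (Ω : Set DeltaDelta.Plane) (hΩ : Bornology.IsBounded Ω) (z : ℂ),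
      z ∉ DeltaDelta.idealSet →
      ∀ (N : ℕ) (hN : 0 < N) (a : DeltaDelta.Plane),
        (∀ f : DeltaDelta.gridIndex Ω hΩ a N hN → ℂ,
          ∃! u : DeltaDelta.gridIndex Ω hΩ a N hN → ℂ,
            ∀ m : DeltaDelta.gridIndex Ω hΩ a N hN,
              z * u m - ((N : ℂ) ^ 2)⁻¹ *
                ∑ n ∈ Finset.univ.erase m,
                  (DeltaDelta.kernel
                    (DeltaDelta.gridPoint a N m - DeltaDelta.gridPoint a N n) : ℂ) * u n
                = f m) ∧
        z ∈ resolventSet ℂ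
          (DeltaDelta.systemOperator a N (DeltaDelta.gridIndex Ω hΩ a N hN)) ∧
        ‖resolvent (DeltaDelta.systemOperator a N (DeltaDelta.gridIndex Ω hΩ a N hN)) z‖
          ≤ (Metric.infDist z DeltaDelta.idealSet)⁻¹ := by
  refine ⟨⟨fun τ hτ => (DeltaDelta.tendsto_symbol hτ).1, DeltaDelta.memLp_symbol,
    DeltaDelta.tendsto_eLpNorm_symbol_sub, fun τ hτ => (DeltaDelta.tendsto_symbol hτ).2⟩, ?_⟩
  intro Ω hΩ z hz N hN a
  set ω := DeltaDelta.gridIndex Ω hΩ a N hN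
  -- Closedness of the interval turns `z ∉ idealSet` into a positive distance.
  have hd : 0 < Metric.infDist z DeltaDelta.idealSet :=
    (DeltaDelta.isClosed_idealSet.notMem_iff_infDist_pos DeltaDelta.idealSet_nonempty).1 hz
  obtain ⟨hunit, hnorm⟩ := DeltaDelta.isUnit_and_norm_inverse_le hd
    (DeltaDelta.infDist_mul_norm_le a hN ω z)
  refine ⟨fun f => ?_, hunit, hnorm⟩
  obtain ⟨hinj, hsurj⟩ := ContinuousLinearMap.isUnit_iff_bijective.1 hunit
  obtain ⟨v, hv⟩ := hsurj (WithLp.toLp 2 f)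
  refine ⟨v.ofLp, fun m => ?_, fun w hw => ?_⟩
  · rw [← DeltaDelta.algebraMap_sub_systemOperator_apply, WithLp.toLp_ofLp, hv]
  · have h : WithLp.toLp 2 w = v := by
      apply hinj
      rw [hv]
      ext m
      rw [DeltaDelta.algebraMap_sub_systemOperator_apply]
      exact hw m
    rw [← h]
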